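/- Let $P\subset\mathbb Z^2$ be a polyomino, i.e. a finite set of $n=|P|\ge 1$ grid points (positions) whose induced grid graph $G_P$ (adjacency = unit distance) is connected; elements of $P$ are called tiles, each tile being the unit square centred at its position. For a position $p$ let $N[p]$ be the set of its four adjacent positions. A position is free if it is not occupied by a tile. * $P$ is degenerate if there are tiles $t_1,t_2\in P$ whose unit squares share exactly one point and $N[t_1]\cap N[t_2]$ contains no tile of $P$. * $P$ is $3$-empty if for all free positions $p_i,p_j$ (possibly equal) in the same connected component of $G_{\mathbb Z^2\setminus P}$ there is a $3\times 3$ square of positions that initially contains $p_i$ and that can be translated by unit steps so that it eventually contains $p_j$, without ever containing a position of $P$. * The workspace is a region of $2n\times 2n$ positions with lower left position $(0,0)$; it contains a seed tile at $(n,n)$. A single tile can move within the workspace from a free position $p$ to an adjacent position $q$ if all positions of $N[p]$ are free. A construction step is a (finite) sequence of moves that takes a tile from $(0,0)$ to a free position adjacent to an occupied position, where the tile is then added to the assembly. $P$ is constructible if, starting with the seed tile, some finite sequence of construction steps produces a set of tiles equal to a translate of $P$. Corollary. Every non-degenerate, $3$-empty polyomino is constructible. -/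

import Mathlib

namespace SingleStepTilt

/-- Positions are the grid points of the plane. A tile is identified with its position. -/
abbrev Pos : Type := ℤ × ℤ

/-- The grid graph on all positions: two positions are adjacent iff they are at unit distance. -/
def gridGraph : SimpleGraph Pos where
  Adj p q := |p.1 - q.1| + |p.2 - q.2| = 1
  symm := ⟨fun p q h => by rwa [abs_sub_comm q.1 p.1, abs_sub_comm q.2 p.2]⟩
  loopless := ⟨fun p h => by simp at h⟩

/-- `N p` is the set of the four positions adjacent to `p`. -/
def N (p : Pos) : Set Pos := gridGraph.neighborSet p

/-- `p` and `q` lie in `A`, in the same connected component of the grid graph induced by `A`. -/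
def JoinedIn (A : Set Pos) (p q : Pos) : Prop :=
  ∃ (hp : p ∈ A) (hq : q ∈ A), (gridGraph.induce A).Reachable ⟨p, hp⟩ ⟨q, hq⟩

/-- A finite set of positions is a polyomino if its induced grid graph is connected
(in particular it is non-empty). -/
def IsPolyomino (P : Finset Pos) : Prop :=
  (gridGraph.induce (P : Set Pos)).Connected

/-- The unit squares centred at `p` and `q` have exactly one point in common. -/
def ShareOnePoint (p q : Pos) : Prop :=
  |p.1 - q.1| = 1 ∧ |p.2 - q.2| = 1

/-- Two tiles of `P` share exactly one point and no tile of `P` is adjacent to both. -/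
def IsDegenerate (P : Finset Pos) : Prop :=
  ∃ t₁ ∈ P, ∃ t₂ ∈ P, ShareOnePoint t₁ t₂ ∧ ∀ t ∈ P, t ∉ N t₁ ∩ N t₂

/-- The positions covered by the `c × c` square whose lower left position is `a`. -/
def square (c : ℕ) (a : Pos) : Set Pos :=
  {p | a.1 ≤ p.1 ∧ p.1 < a.1 + c ∧ a.2 ≤ p.2 ∧ p.2 < a.2 + c}

/-- The placements (given by the lower left position) of a `c × c` square that do not overlap
with any tile of `P`. -/
def clearPlacements (c : ℕ) (P : Finset Pos) : Set Pos :=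
  {a | Disjoint (square c a) (P : Set Pos)}

/-- `P` is `c`-empty: for all free positions `p`, `q` (possibly equal) in the same component of the
free positions, some `c × c` square overlapping with `p` can be moved by unit steps, never
overlapping with `P`, until it overlaps with `q`. -/
def IsEmptyFor (c : ℕ) (P : Finset Pos) : Prop :=
  ∀ p q : Pos, JoinedIn (P : Set Pos)ᶜ p q →
    ∃ a b : Pos, p ∈ square c a ∧ q ∈ square c b ∧ JoinedIn (clearPlacements c P) a b

/-- The workspace of `2n × 2n` positions anchored at `(0, 0)`. -/
def workspace (n : ℕ) : Set Pos :=
  {p | 0 ≤ p.1 ∧ p.1 < 2 * n ∧ 0 ≤ p.2 ∧ p.2 < 2 * n}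

/-- With `A` the set of occupied positions, a single tile located at the free position `p` of the
workspace can move to the adjacent position `q` of the workspace if all of `N p` is free
(in particular `q` is free). -/
def Move (n : ℕ) (A : Finset Pos) (p q : Pos) : Prop :=
  p ∈ workspace n ∧ q ∈ workspace n ∧ p ∉ A ∧ q ∈ N p ∧ ∀ r ∈ N p, r ∉ A

/-- A construction step: a sequence of moves takes a tile from `(0, 0)` to the free position `q`,
which is adjacent to an occupied position. -/
def ConstructionStep (n : ℕ) (A : Finset Pos) (q : Pos) : Prop :=
  Relation.ReflTransGen (Move n A) (0, 0) q ∧ q ∉ A ∧ ∃ r ∈ A, r ∈ N q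

/-- The sets of positions that can be obtained in the workspace of size `2n × 2n` from the seed tile
at `(n, n)` by a finite sequence of construction steps. -/
inductive Assembles (n : ℕ) : Finset Pos → Prop
  | seed : Assembles n {((n : ℤ), (n : ℤ))}
  | step (A : Finset Pos) (q : Pos) (hA : Assembles n A) (hq : ConstructionStep n A q) :
      Assembles n (insert q A)

/-- A shape with `n` tiles is constructible if some translate of it can be assembled in the
workspace of size `2n × 2n`. -/
def IsConstructible (P : Finset Pos) : Prop :=
  ∃ v : Pos, Assembles P.card (P.image fun p => p + v)

end SingleStepTilt

namespace SingleStepTilt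

open Relation

/-! The shape is dismantled backwards, by induction on the number of tiles. Each round removes one
tile or a column of four, so that the rest keeps the seed, is again connected, non-degenerate and
`3`-empty (`Nice`), and the removed tiles can be brought back from far away.

Let `F` be `P` with its holes filled. Unless only the seed is left, `F` has a part that hangs on a
single tile `t`, avoids the seed and contains no cut vertex (`exists_lobe`). Up to rotation this
part extends further right than `t`; the topmost tile `u = (x, y)` of its last column then has
nothing of `F` above it or to its right. By `3`-emptiness a clear square can travel around this
convex corner, whereas a second tile close by, together with a path of tiles to `u`, would fence it
in. Hence `u` is the only tile of the `4 × 4` block whose lower left position is `u`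
(`Nice.corner_free`): it can be reached, and its removal makes room for a clear square.

If `u` does not link a left and a lower neighbour around a free `(x - 1, y - 1)`, removing it
preserves `Nice` (`Nice.remove_corner`). Otherwise, as `u` is no cut vertex of `F`, that position
lies in a hole of `P`. The clear square in the hole forces a straight wall `(x, y), ..., (x, y -
3)`, and removing these four tiles lets the square slide out (`HoleCorner.nice_cut`). Connectivity
survives because the tiles around a hole close up to a ring (`Nice.conn_of_hole`).

Finally, a seed of maximal coordinate sum leaves a free margin in the workspace, into which the
paths are pushed. -/

/-! ### Grid paths and clear squares -/

theorem adj_iff {p q : Pos} : gridGraph.Adj p q ↔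
    (q.1 = p.1 + 1 ∧ q.2 = p.2) ∨ (q.1 = p.1 - 1 ∧ q.2 = p.2) ∨
    (q.1 = p.1 ∧ q.2 = p.2 + 1) ∨ (q.1 = p.1 ∧ q.2 = p.2 - 1) := by
  change |p.1 - q.1| + |p.2 - q.2| = 1 ↔ _
  rcases abs_cases (p.1 - q.1) with h | h <;> rcases abs_cases (p.2 - q.2) with h' | h' <;> omega

theorem adj_right (x y : ℤ) : gridGraph.Adj (x, y) (x + 1, y) := by simp [adj_iff]
theorem adj_left (x y : ℤ) : gridGraph.Adj (x, y) (x - 1, y) := by simp [adj_iff]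
theorem adj_up (x y : ℤ) : gridGraph.Adj (x, y) (x, y + 1) := by simp [adj_iff]
theorem adj_down (x y : ℤ) : gridGraph.Adj (x, y) (x, y - 1) := by simp [adj_iff]

/-- A neighbour of `(x, y)` is one of the four translates. -/
theorem adj_cases {x y : ℤ} {q : Pos} (h : gridGraph.Adj (x, y) q) :
    q = (x + 1, y) ∨ q = (x - 1, y) ∨ q = (x, y + 1) ∨ q = (x, y - 1) := by
  obtain ⟨a, b⟩ := q
  simpa [adj_iff] using h

/-- A unit step inside `A`. -/
def Link (A : Set Pos) (p q : Pos) : Prop := p ∈ A ∧ q ∈ A ∧ gridGraph.Adj p q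

/-- `p` and `q` are joined by a grid path inside `A`. -/
def Conn (A : Set Pos) (p q : Pos) : Prop := p ∈ A ∧ ReflTransGen (Link A) p q

namespace Conn
variable {A B : Set Pos} {p q r : Pos}

theorem refl (h : p ∈ A) : Conn A p p := ⟨h, .refl⟩
theorem left_mem (h : Conn A p q) : p ∈ A := h.1
theorem right_mem (h : Conn A p q) : q ∈ A := by
  rcases h.2.cases_tail with h' | ⟨_, _, h'⟩
  · exact h' ▸ h.1
  · exact h'.2.1
theorem trans (h : Conn A p q) (h' : Conn A q r) : Conn A p r := ⟨h.1, h.2.trans h'.2⟩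
theorem symm (h : Conn A p q) : Conn A q p := by
  obtain ⟨hp, h⟩ := h
  induction h with
  | refl => exact .refl hp
  | tail _ h ih => exact ⟨h.2.1, .head ⟨h.2.1, h.1, h.2.2.symm⟩ ih.2⟩
theorem single (hp : p ∈ A) (hq : q ∈ A) (h : gridGraph.Adj p q) : Conn A p q :=
  ⟨hp, .single ⟨hp, hq, h⟩⟩
theorem mono (h : Conn A p q) (hAB : A ⊆ B) : Conn B p q :=
  ⟨hAB h.1, ReflTransGen.mono (fun _ _ h => ⟨hAB h.1, hAB h.2.1, h.2.2⟩) _ _ h.2⟩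

/-- A property of positions that is stable under unit steps inside `A` spreads along paths. -/
theorem induct {C : Pos → Prop} (h : Conn A p q) (hp : C p)
    (step : ∀ x y, x ∈ A → y ∈ A → gridGraph.Adj x y → C x → C y) : C q := by
  obtain ⟨_, h⟩ := h
  induction h with
  | refl => exact hp
  | tail _ h ih => exact step _ _ h.1 h.2.1 h.2.2 ih

/-- A function that is constant along unit steps to the right and upwards is constant along paths. -/
theorem const {f : Pos → ℤ} (h : Conn A p q)
    (hr : ∀ x y : ℤ, (x, y) ∈ A → (x + 1, y) ∈ A → f (x + 1, y) = f (x, y))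
    (hu : ∀ x y : ℤ, (x, y) ∈ A → (x, y + 1) ∈ A → f (x, y + 1) = f (x, y)) : f q = f p := by
  refine h.induct (C := fun z => f z = f p) rfl fun x y hx hy hxy h => ?_
  rw [← h]
  obtain ⟨a, b⟩ := x
  rcases adj_cases hxy with rfl | rfl | rfl | rfl
  · exact hr _ _ hx hy
  · simpa using (hr (a - 1) b hy (by simpa using hx)).symm
  · exact hu _ _ hx hy
  · simpa using (hu a (b - 1) hy (by simpa using hx)).symm
end Conn

theorem conn_of_joinedIn {A : Set Pos} {p q : Pos} (h : JoinedIn A p q) : Conn A p q := by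
  obtain ⟨hp, hq, ⟨w⟩⟩ := h
  have key : ∀ (x y : A), (gridGraph.induce A).Walk x y → Conn A x y := by
    intro x y w
    induction w with
    | nil => exact .refl (Subtype.coe_prop _)
    | cons h _ ih => exact (Conn.single (Subtype.coe_prop _) (Subtype.coe_prop _) h).trans ih
  exact key _ _ w

theorem Conn.joinedIn {A : Set Pos} {p q : Pos} (h : Conn A p q) : JoinedIn A p q := by
  refine h.induct (C := JoinedIn A p) ⟨h.1, h.1, .refl _⟩ ?_
  rintro x y hx hy hxy ⟨_, _, h'⟩
  exact ⟨h.1, hy, h'.trans (SimpleGraph.Adj.reachable (by exact hxy))⟩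

/-- `p` lies in the `3 × 3` square centred at `c`. -/
def Near (p c : Pos) : Prop := c.1 - 1 ≤ p.1 ∧ p.1 ≤ c.1 + 1 ∧ c.2 - 1 ≤ p.2 ∧ p.2 ≤ c.2 + 1

/-- The centres of the `3 × 3` squares that avoid `Q`. -/
def Clear (Q : Set Pos) : Set Pos := {c | ∀ p ∈ Q, ¬ Near p c}

theorem Clear.anti {Q R : Set Pos} (h : Q ⊆ R) : Clear R ⊆ Clear Q := fun _ hc p hp => hc p (h hp)

theorem notMem_of_clear {Q : Set Pos} {c p : Pos} (hc : c ∈ Clear Q) (h : Near p c) : p ∉ Q :=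
  fun hp => hc p hp h

/-- Connected, non-degenerate and `3`-empty sets of positions. -/
structure Nice (Q : Set Pos) : Prop where
  conn : ∀ p ∈ Q, ∀ q ∈ Q, Conn Q p q
  nondeg : ∀ p ∈ Q, ∀ q ∈ Q, (q.1 = p.1 + 1 ∨ q.1 = p.1 - 1) → (q.2 = p.2 + 1 ∨ q.2 = p.2 - 1) →
    (p.1, q.2) ∈ Q ∨ (q.1, p.2) ∈ Q
  empty : ∀ p q, Conn Qᶜ p q → ∃ a b, Near p a ∧ Near q b ∧ Conn (Clear Q) a b

/-- All positions of a clear square are joined to each other outside `Q`. -/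
theorem conn_of_near {Q : Set Pos} {c p : Pos} (hc : c ∈ Clear Q) (h : Near p c) :
    Conn Qᶜ c p := by
  obtain ⟨x, y⟩ := c
  obtain ⟨a, b⟩ := p
  have hm : ∀ a b : ℤ, Near (a, b) (x, y) → (a, b) ∈ Qᶜ := fun a b h => notMem_of_clear hc h
  have h1 : Conn Qᶜ (x, y) (a, y) := by
    have h0 := hm x y (by simp [Near])
    have h1 := hm a y (by simp only [Near] at h ⊢; omega)
    obtain rfl | rfl | rfl : a = x ∨ a = x + 1 ∨ a = x - 1 := by simp only [Near] at h; omega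
    · exact .refl h0
    · exact .single h0 h1 (adj_right _ _)
    · exact .single h0 h1 (adj_left _ _)
  refine h1.trans ?_
  have h0 := h1.right_mem
  have h2 := hm a b h
  obtain rfl | rfl | rfl : b = y ∨ b = y + 1 ∨ b = y - 1 := by simp only [Near] at h; omega
  · exact .refl h0
  · exact .single h0 h2 (adj_up _ _)
  · exact .single h0 h2 (adj_down _ _)

/-! ### Winding numbers and convex corners -/

/-- The contribution of the endpoint `p` of a walk to the change of winding numbers across the
row `j + 1`. -/
def rayIndicator (i j : ℤ) (p : Pos) : ℤ := if i < p.1 ∧ p.2 = j + 1 then 1 else 0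

/-- The crossing of the unit step from `p` to `q` with the horizontal ray that starts at
`(i + 1/2, j + 1/2)` and points to the right. -/
def rayCrossing (i j : ℤ) (p q : Pos) : ℤ :=
  if i < p.1 ∧ i < q.1 then (if j < q.2 then 1 else 0) - (if j < p.2 then 1 else 0) else 0

/-- Winding numbers around the points `(i + 1/2, j + 1/2)` of a walk inside `A`. They change only
where an edge of the walk is crossed, up to a contribution of the endpoints. -/
theorem exists_winding {A : Set Pos} {u v : Pos} (h : ReflTransGen (Link A) u v) :
    ∃ W : ℤ → ℤ → ℤ,
      (∀ i j, ((i + 1, j) ∉ A ∨ (i + 1, j + 1) ∉ A) → W (i + 1) j = W i j) ∧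
      (∀ i j, ((i, j + 1) ∉ A ∨ (i + 1, j + 1) ∉ A) →
        W i j - W i (j + 1) = rayIndicator i j v - rayIndicator i j u) := by
  induction h with
  | refl => exact ⟨fun _ _ => 0, by simp⟩
  | @tail p q _ hpq ih =>
    obtain ⟨W, h1, h2⟩ := ih
    obtain ⟨hp, hq, hpq⟩ := hpq
    obtain ⟨a, b⟩ := p
    -- The rays at heights `j` and `j + 1` count a step differently only if it starts or ends in row
    -- `j + 1`, so the endpoint terms telescope.
    refine ⟨fun i j => W i j + rayCrossing i j (a, b) q, fun i j hA => ?_, fun i j hA => ?_⟩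
    · dsimp only
      rw [h1 i j hA]
      have e1 : ¬ ((a, b) = (i + 1, j) ∧ q = (i + 1, j + 1)) := by
        rintro ⟨h, h'⟩; rw [← h, ← h'] at hA; tauto
      have e2 : ¬ ((a, b) = (i + 1, j + 1) ∧ q = (i + 1, j)) := by
        rintro ⟨h, h'⟩; rw [← h, ← h'] at hA; tauto
      rcases adj_cases hpq with rfl | rfl | rfl | rfl <;>
        simp only [Prod.mk.injEq] at e1 e2 <;> simp only [rayCrossing] <;> split_ifs <;> omega
    · have := h2 i j hA
      have e1 : ¬ ((a, b) = (i, j + 1) ∧ q = (i + 1, j + 1)) := by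
        rintro ⟨h, h'⟩; rw [← h, ← h'] at hA; tauto
      have e2 : ¬ ((a, b) = (i + 1, j + 1) ∧ q = (i, j + 1)) := by
        rintro ⟨h, h'⟩; rw [← h, ← h'] at hA; tauto
      suffices rayCrossing i j (a, b) q - rayCrossing i (j + 1) (a, b) q =
          rayIndicator i j q - rayIndicator i j (a, b) by dsimp only; omega
      rcases adj_cases hpq with rfl | rfl | rfl | rfl <;>
        simp only [Prod.mk.injEq] at e1 e2 <;> simp only [rayCrossing, rayIndicator] <;>
        split_ifs <;> omega

/-- Clear squares cannot pass between two tiles `(x, y)` and `(m, n)` that are close to each other,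
so that winding numbers, corrected by the crossings with a path between the tiles, are the same for
joined squares. -/
theorem winding_eq_of_conn_clear {Q : Set Pos} {x y m n : ℤ} (hu : (x, y) ∈ Q) (hv : (m, n) ∈ Q)
    (hm : x < m) (hm' : m ≤ x + 3) (hn : y < n) (hn' : n ≤ y + 3) {W : ℤ → ℤ → ℤ}
    (W1 : ∀ i j, ((i + 1, j) ∉ Q ∨ (i + 1, j + 1) ∉ Q) → W (i + 1) j = W i j)
    (W2 : ∀ i j, ((i, j + 1) ∉ Q ∨ (i + 1, j + 1) ∉ Q) →
      W i j - W i (j + 1) = rayIndicator i j (m, n) - rayIndicator i j (x, y))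
    {a b : Pos} (hab : Conn (Clear Q) a b) {f : Pos → ℤ}
    (hf : ∀ i j, f (i + 1, j + 1) = W i j + ((if i < m ∧ n ≤ j then 1 else 0) -
      (if i < x ∧ y ≤ j then 1 else 0) - (if x ≤ i ∧ i < m ∧ y + 1 ≤ j then 1 else 0))) :
    f b = f a := by
  -- The indicators in `hf` close the walk by the path through `(x, y)`, `(x, y + 1)`, `(m, y + 1)`,
  -- `(m, n)`; `f` is the winding number around the point half a step below and left of the centre.
  -- Since both offsets are at most `3`, a square that steps across the closing path would contain
  -- one of the two tiles.
  refine hab.const (fun i j hi hj => ?_) (fun i j hi hj => ?_) <;>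
  obtain ⟨i, rfl⟩ : ∃ k, i = k + 1 := ⟨i - 1, by ring⟩ <;>
  obtain ⟨j, rfl⟩ : ∃ k, j = k + 1 := ⟨j - 1, by ring⟩ <;>
  have i1 := hi _ hu <;> have i2 := hi _ hv <;> have j1 := hj _ hu <;> have j2 := hj _ hv <;>
  simp only [Near] at i1 i2 j1 j2 <;>
  rw [hf, hf]
  · rw [W1 i j (.inl (notMem_of_clear hi (by simp only [Near]; omega))), add_right_inj]
    clear hf W1 W2 hi hj
    split_ifs <;> omega
  · have k := W2 i j (.inl (notMem_of_clear hi (by simp only [Near]; omega)))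
    simp only [rayIndicator] at k
    generalize W i j = w1 at *
    generalize W i (j + 1) = w2 at *
    clear hf W1 W2 hi hj hab hu hv
    by_cases c1 : i < x
    · simp only [c1, show i < m by omega, show ¬ x ≤ i by omega, true_and, false_and, if_false] at k ⊢
      split_ifs at k ⊢ <;> omega
    by_cases c2 : i < m
    · simp only [c1, c2, show x ≤ i by omega, true_and, false_and, if_false] at k ⊢
      split_ifs at k ⊢ <;> omega
    · simp only [c1, c2, false_and, and_false, if_false] at k ⊢
      omega

/-- No tile blocks the `3 × 3` squares next to a convex corner. -/
theorem Nice.corner_free {Q : Set Pos} (hQ : Nice Q) {x y : ℤ} (hu : (x, y) ∈ Q)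
    (hr : (x + 1, y) ∉ Q) (ht : (x, y + 1) ∉ Q) {v : Pos} (hv : v ∈ Q)
    (h1 : x ≤ v.1) (h2 : v.1 ≤ x + 3) (h3 : y ≤ v.2) (h4 : v.2 ≤ y + 3) : v = (x, y) := by
  obtain ⟨m, n⟩ := v
  by_contra hne
  have hne : ¬ (m = x ∧ n = y) := fun h => hne (by simp [h])
  dsimp only at h1 h2 h3 h4
  have hd : (x + 1, y + 1) ∉ Q := fun h => by
    have := hQ.nondeg _ hu _ h (by simp) (by simp)
    tauto
  obtain ⟨⟨a1, a2⟩, ⟨b1, b2⟩, ha, hb, hab⟩ := hQ.empty (x + 1, y) (x, y + 1)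
    ((Conn.single hr hd (adj_up _ _)).trans (Conn.single hd ht (by simp [adj_iff])))
  have ha' := hab.left_mem
  have hb' := hab.right_mem
  have hau := ha' _ hu
  have hav := ha' _ hv
  have hbu := hb' _ hu
  have hbv := hb' _ hv
  simp only [Near] at ha hb hau hav hbu hbv
  obtain ⟨W, W1, W2⟩ := exists_winding (hQ.conn _ hu _ hv).2
  -- Each square contains a neighbour of the corner but not the corner, which fixes one coordinate
  -- of its centre.
  obtain rfl : a1 = x + 1 + 1 := by omega
  obtain rfl : b2 = y + 1 + 1 := by omega
  obtain ⟨a2, rfl⟩ : ∃ k, a2 = k + 1 := ⟨a2 - 1, by ring⟩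
  obtain ⟨b1, rfl⟩ : ∃ k, b1 = k + 1 := ⟨b1 - 1, by ring⟩
  have hm : x < m := by omega
  have hn : y < n := by omega
  have key := winding_eq_of_conn_clear hu hv hm h2 hn h4 W1 W2 hab
    (f := fun c => W (c.1 - 1) (c.2 - 1) + ((if c.1 - 1 < m ∧ n ≤ c.2 - 1 then 1 else 0) -
      (if c.1 - 1 < x ∧ y ≤ c.2 - 1 then 1 else 0) -
      (if x ≤ c.1 - 1 ∧ c.1 - 1 < m ∧ y + 1 ≤ c.2 - 1 then 1 else 0)))
    (fun i j => by simp only [add_sub_cancel_right])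
  have s1 : W (x + 1) y = W x y := W1 x y (.inl hr)
  have s2 := W2 x y (.inl ht)
  have s3 : W (x + 1) a2 = W (x + 1) y := by
    have t : ∀ j, j + 1 ≤ y → (x + 1, j + 1) ∉ Q → W (x + 1) j = W (x + 1) (j + 1) := by
      intro j hj h
      have := W2 (x + 1) j (.inl h)
      rw [rayIndicator, rayIndicator, if_neg (by simp only; omega), if_neg (by simp only; omega)]
        at this
      omega
    have t1 := t (y - 1) (by omega) (by simpa using hr)
    rw [sub_add_cancel] at t1
    obtain rfl | rfl | rfl : a2 = y ∨ a2 = y - 1 ∨ a2 = y - 1 - 1 := by omega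
    · rfl
    · exact t1
    · have t2 := t (y - 1 - 1) (by omega) (notMem_of_clear ha' (by simp only [Near]; omega))
      rw [sub_add_cancel] at t2
      rw [t2, t1]
  have s4 : W b1 (y + 1) = W x (y + 1) := by
    have t1 := W1 (x - 1) (y + 1) (.inl (by simpa using ht))
    rw [sub_add_cancel] at t1
    obtain rfl | rfl | rfl : b1 = x ∨ b1 = x - 1 ∨ b1 = x - 1 - 1 := by omega
    · rfl
    · exact t1.symm
    · have t2 := W1 (x - 1 - 1) (y + 1) (.inl (notMem_of_clear hb' (by simp only [Near]; omega)))
      rw [sub_add_cancel] at t2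
      rw [← t2, t1]
  clear hav hbv hau hbu W1 W2 hab ha' hb'
  -- At the first square all corrections vanish; at the second the corrected winding number is
  -- smaller by one.
  simp only [add_sub_cancel_right, s3, s4, s1] at key
  simp only [rayIndicator, hm, true_and, lt_irrefl, false_and, if_false] at s2
  rw [if_neg (by omega : ¬ (x + 1 < m ∧ n ≤ a2)), if_neg (by omega : ¬ (x + 1 < x ∧ y ≤ a2)),
    if_neg (by omega : ¬ (x ≤ x + 1 ∧ x + 1 < m ∧ y + 1 ≤ a2))] at key
  by_cases c : b1 = x
  · subst c
    split_ifs at key s2 <;> omega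
  · rw [if_pos (by omega : b1 < x ∧ y ≤ y + 1), if_neg (by omega : ¬ (x ≤ b1 ∧ b1 < m ∧ y + 1 ≤ y + 1))]
      at key
    split_ifs at key s2 <;> omega

/-- If the complement of `F` is connected around a tile with exactly two neighbours that share a
free common neighbour, then these neighbours are not joined after the tile is removed. -/
theorem not_conn_of_cut_corner {F : Set Pos} {x y : ℤ}
    (ht : (x, y + 1) ∉ F) (hl : (x - 1, y) ∈ F) (hd : (x, y - 1) ∈ F)
    (hc : Conn Fᶜ (x - 1, y - 1) (x, y + 1)) : ¬ Conn (F \ {(x, y)}) (x - 1, y) (x, y - 1) := by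
  intro h
  obtain ⟨W, W1, W2⟩ := exists_winding h.2
  have hu : (x, y) ∉ F \ {(x, y)} := by simp
  have hF : ∀ p, p ∈ Fᶜ → p ∉ F \ {(x, y)} := fun p hp hp' => hp hp'.1
  -- The indicator closes the walk through the removed tile `(x, y)`; `f` is the winding number
  -- around the point half a step above and right of `c`, and no step between positions outside `F`
  -- crosses the closed curve.
  let f : Pos → ℤ := fun c => W c.1 c.2 + (if c.1 ≤ x - 1 ∧ c.2 = y - 1 then 1 else 0)
  have key : f (x, y + 1) = f (x - 1, y - 1) := by
    refine hc.const (fun i j hi hj => ?_) (fun i j hi hj => ?_)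
    · have k := W1 i j (.inl (hF _ hj))
      have n1 : ¬ (i + 1 = x ∧ j = y - 1) := by rintro ⟨h1, h2⟩; rw [h1, h2] at hj; exact hj hd
      simp only [f]
      rw [k]
      split_ifs <;> omega
    · have k := W2 i j (.inl (hF _ hj))
      have n1 : ¬ (i = x - 1 ∧ j + 1 = y) := by rintro ⟨h1, h2⟩; rw [h1, h2] at hj; exact hj hl
      have n2 : ¬ (i = x - 1 ∧ j = y) := by rintro ⟨h1, h2⟩; rw [h1, h2] at hi; exact hi hl
      simp only [rayIndicator] at k
      simp only [f]
      split_ifs at k ⊢ <;> omega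
  -- The unclosed walk avoids `(x, y)`, so `W` agrees at the two points and the indicator remains as
  -- a difference of one.
  have k1 := W2 (x - 1) (y - 1) (.inr (by simp))
  have k2 := W1 (x - 1) y (.inl (by simp))
  have k3 := W2 x y (.inl (hF _ ht))
  rw [sub_add_cancel] at k1 k2
  rw [rayIndicator, rayIndicator, if_neg (by simp only; omega), if_neg (by simp only; omega)] at k1 k3
  simp only [f] at key
  rw [if_neg (by omega), if_pos (by simp)] at key
  omega

/-! ### Removing a convex corner -/

/-- A path can be rerouted around `u` if the neighbours of `u` are joined to each other. -/
theorem Conn.diff {B : Set Pos} {p q u : Pos} (h : Conn B p q) (hp : p ≠ u) (hq : q ≠ u)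
    (hn : ∀ a ∈ B, ∀ b ∈ B, gridGraph.Adj u a → gridGraph.Adj u b → Conn (B \ {u}) a b) :
    Conn (B \ {u}) p q := by
  have key : (q ≠ u → Conn (B \ {u}) p q) ∧
      (q = u → ∀ b ∈ B, gridGraph.Adj u b → Conn (B \ {u}) p b) := by
    refine h.induct (C := fun q => (q ≠ u → Conn (B \ {u}) p q) ∧
      (q = u → ∀ b ∈ B, gridGraph.Adj u b → Conn (B \ {u}) p b))
      ⟨fun _ => .refl ⟨h.1, hp⟩, fun h => absurd h hp⟩ ?_
    rintro a b ha hb hab ⟨h1, h2⟩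
    by_cases hau : a = u
    · subst hau
      exact ⟨fun _ => h2 rfl b hb hab, fun h => absurd h.symm hab.ne⟩
    · refine ⟨fun hbu => (h1 hau).trans (.single ⟨ha, hau⟩ ⟨hb, hbu⟩ hab), ?_⟩
      rintro rfl c hc hbc
      exact (h1 hau).trans (hn _ ha _ hc hab.symm hbc)
  exact key.1 hq

theorem compl_diff_diff {Q : Set Pos} {u : Pos} (hu : u ∈ Q) : (Q \ {u})ᶜ \ {u} = Qᶜ := by
  ext p
  simp only [Set.mem_sdiff, Set.mem_compl_iff, Set.mem_singleton_iff]
  constructor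
  · tauto
  · intro h
    exact ⟨fun h' => h h'.1, fun h' => h (h' ▸ hu)⟩

/-- In a connected set with another tile, every tile has a neighbour. -/
theorem exists_adj_of_conn {Q : Set Pos} {u v : Pos} (h : Conn Q u v) (huv : u ≠ v) :
    ∃ r ∈ Q, gridGraph.Adj u r := by
  rcases h.2.cases_head with h' | ⟨r, h', _⟩
  · exact absurd h' huv
  · exact ⟨r, h'.2.1, h'.2.2⟩

namespace Nice
variable {Q : Set Pos} {x y : ℤ}

theorem corner_diag (hQ : Nice Q) (hu : (x, y) ∈ Q) (hr : (x + 1, y) ∉ Q) (ht : (x, y + 1) ∉ Q) :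
    (x + 1, y + 1) ∉ Q := fun h => by
  have := hQ.nondeg _ hu _ h (by simp) (by simp)
  tauto

/-- The free neighbours of a convex corner are joined to each other. -/
theorem corner_conn_compl (hQ : Nice Q) (hu : (x, y) ∈ Q) (hr : (x + 1, y) ∉ Q)
    (ht : (x, y + 1) ∉ Q) {a : Pos} (ha : a ∉ Q) (hua : gridGraph.Adj (x, y) a) :
    Conn Qᶜ (x + 1, y) a := by
  have hd := hQ.corner_diag hu hr ht
  have h1 : Conn Qᶜ (x + 1, y) (x, y + 1) :=
    (Conn.single hr hd (adj_up _ _)).trans (Conn.single hd ht (by simp [adj_iff]))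
  rcases adj_cases hua with rfl | rfl | rfl | rfl
  · exact .refl hr
  · have h : (x - 1, y + 1) ∉ Q := fun h => by
      have := hQ.nondeg _ hu _ h (by simp) (by simp)
      tauto
    exact (h1.trans (.single ht h (by simp [adj_iff]))).trans (.single h ha (by simp [adj_iff]))
  · exact h1
  · have h : (x + 1, y - 1) ∉ Q := fun h => by
      have := hQ.nondeg _ hu _ h (by simp) (by simp)
      tauto
    exact (Conn.single hr h (by simp [adj_iff])).trans (.single h ha (by simp [adj_iff]))

/-- Vacating the corner merges no components of the free positions, because its free neighbours are
already joined. -/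
theorem corner_conn_compl_diff (hQ : Nice Q) (hu : (x, y) ∈ Q) (hr : (x + 1, y) ∉ Q)
    (ht : (x, y + 1) ∉ Q) {p q : Pos} (h : Conn (Q \ {(x, y)})ᶜ p q) (hp : p ≠ (x, y))
    (hq : q ≠ (x, y)) : Conn Qᶜ p q := by
  rw [← compl_diff_diff hu]
  refine h.diff hp hq fun a ha b hb hua hub => ?_
  rw [compl_diff_diff hu]
  exact (hQ.corner_conn_compl hu hr ht (fun h => ha ⟨h, hua.ne'⟩) hua).symm.trans
    (hQ.corner_conn_compl hu hr ht (fun h => hb ⟨h, hub.ne'⟩) hub)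

/-- The square right of a convex corner is joined to squares near all positions that are joined
to the right neighbour of the corner. -/
theorem corner_square (hQ : Nice Q) (hu : (x, y) ∈ Q) (hr : (x + 1, y) ∉ Q)
    (ht : (x, y + 1) ∉ Q) {q : Pos} (h : Conn Qᶜ (x + 1, y) q) :
    ∃ b, Near q b ∧ Conn (Clear Q) (x + 2, y + 1) b := by
  have h1 : (x + 2, y + 1) ∈ Clear Q := fun p hp hn => by
    simp only [Near] at hn
    have := hQ.corner_free hu hr ht hp (by omega) (by omega) (by omega) (by omega)
    subst this
    simp only at hn
    omega
  obtain ⟨⟨a1, a2⟩, b, ha, hb, hab⟩ := hQ.empty _ _ h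
  have ha' := hab.left_mem
  have hau := ha' _ hu
  simp only [Near] at ha hau
  obtain rfl : a1 = x + 2 := by omega
  refine ⟨b, hb, Conn.trans ?_ hab⟩
  obtain rfl | h2 : a2 = y + 1 ∨ a2 ≤ y := by omega
  · exact .refl h1
  -- The squares at heights `y + 1` and `a2` together cover the one at height `y`.
  have h3 : (x + 2, y) ∈ Clear Q := fun p hp hn => by
    have i1 := h1 p hp
    have i2 := ha' p hp
    simp only [Near] at i1 i2 hn
    omega
  refine (Conn.single h1 h3 (by simp [adj_iff])).trans ?_
  obtain rfl | rfl : a2 = y ∨ a2 = y - 1 := by omega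
  · exact .refl h3
  · exact .single h3 ha' (by simp [adj_iff])

/-- The square whose lower left position is a convex corner avoids all other tiles. -/
theorem corner_clear (hQ : Nice Q) (hu : (x, y) ∈ Q) (hr : (x + 1, y) ∉ Q)
    (ht : (x, y + 1) ∉ Q) : (x + 1, y + 1) ∈ Clear (Q \ {(x, y)}) := fun p hp hn => by
  simp only [Near] at hn
  exact hp.2 (hQ.corner_free hu hr ht hp.1 (by omega) (by omega) (by omega) (by omega))

theorem corner_square_diff (hQ : Nice Q) (hu : (x, y) ∈ Q) (hr : (x + 1, y) ∉ Q)
    (ht : (x, y + 1) ∉ Q) {q : Pos} (h : Conn Qᶜ (x + 1, y) q) :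
    ∃ b, Near q b ∧ Conn (Clear (Q \ {(x, y)})) (x + 1, y + 1) b := by
  obtain ⟨b, hb, h⟩ := hQ.corner_square hu hr ht h
  have h' := h.mono (Clear.anti (Set.sdiff_subset (s := Q) (t := {(x, y)})))
  exact ⟨b, hb, (Conn.single (hQ.corner_clear hu hr ht) h'.left_mem (by simp [adj_iff]; omega)).trans h'⟩

/-- Removing a convex corner that is a leaf or belongs to a full `2 × 2` square. -/
theorem remove_corner (hQ : Nice Q) (hu : (x, y) ∈ Q) (hr : (x + 1, y) ∉ Q) (ht : (x, y + 1) ∉ Q)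
    (hb : (x - 1, y) ∈ Q → (x, y - 1) ∈ Q → (x - 1, y - 1) ∈ Q) : Nice (Q \ {(x, y)}) := by
  refine ⟨fun p hp q hq => ?_, fun p hp q hq h1 h2 => ?_, fun p q h => ?_⟩
  · have key : (x - 1, y) ∈ Q → (x, y - 1) ∈ Q → Conn (Q \ {(x, y)}) (x - 1, y) (x, y - 1) := by
      intro h1 h2
      have m3 : (x - 1, y - 1) ∈ Q \ {(x, y)} := ⟨hb h1 h2, by simp⟩
      have m1 : (x - 1, y) ∈ Q \ {(x, y)} := ⟨h1, by simp⟩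
      exact (Conn.single m1 m3 (by simp [adj_iff])).trans
        (.single m3 ⟨h2, by simp⟩ (by simp [adj_iff]))
    refine (hQ.conn p hp.1 q hq.1).diff hp.2 hq.2 fun a ha b hb hua hub => ?_
    rcases adj_cases hua with rfl | rfl | rfl | rfl <;>
    rcases adj_cases hub with rfl | rfl | rfl | rfl <;>
    first
    | contradiction
    | exact .refl ⟨ha, by simp⟩
    | exact key ha hb
    | exact (key hb ha).symm
  · have h := hQ.nondeg p hp.1 q hq.1 h1 h2
    obtain ⟨p1, p2⟩ := p
    obtain ⟨q1, q2⟩ := q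
    simp only [Set.mem_sdiff, Set.mem_singleton_iff, Prod.mk.injEq] at *
    have hr' : ¬ (p1 = x + 1 ∧ p2 = y) := by rintro ⟨rfl, rfl⟩; exact hr hp.1
    have hr'' : ¬ (q1 = x + 1 ∧ q2 = y) := by rintro ⟨rfl, rfl⟩; exact hr hq.1
    have ht' : ¬ (p1 = x ∧ p2 = y + 1) := by rintro ⟨rfl, rfl⟩; exact ht hp.1
    have ht'' : ¬ (q1 = x ∧ q2 = y + 1) := by rintro ⟨rfl, rfl⟩; exact ht hq.1
    -- Only the left and lower neighbours of the corner lose a common neighbour; `hb` supplies the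
    -- opposite one.
    by_cases e1 : p1 = x ∧ q2 = y
    · obtain ⟨rfl, rfl⟩ := e1
      obtain rfl : p2 = q2 - 1 := by omega
      obtain rfl : q1 = p1 - 1 := by omega
      exact .inr ⟨hb hq.1 hp.1, by omega⟩
    by_cases e2 : q1 = x ∧ p2 = y
    · obtain ⟨rfl, rfl⟩ := e2
      obtain rfl : q2 = p2 - 1 := by omega
      obtain rfl : p1 = q1 - 1 := by omega
      exact .inl ⟨hb hp.1 hq.1, by omega⟩
    exact h.imp (⟨·, e1⟩) (⟨·, e2⟩)
  · have hc := hQ.corner_clear hu hr ht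
    have hrr : (x + 1, y) ∈ (Q \ {(x, y)})ᶜ := fun h => hr h.1
    have step : ∀ q, q ≠ (x, y) → Conn (Q \ {(x, y)})ᶜ (x, y) q →
        ∃ b, Near q b ∧ Conn (Clear (Q \ {(x, y)})) (x + 1, y + 1) b := fun q hq h =>
      hQ.corner_square_diff hu hr ht (hQ.corner_conn_compl_diff hu hr ht
        ((Conn.single hrr h.left_mem (by simp [adj_iff])).trans h) (by simp) hq)
    have hn : Near (x, y) (x + 1, y + 1) := by simp only [Near]; omega
    by_cases hp : p = (x, y) <;> by_cases hq : q = (x, y)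
    · subst hp hq
      exact ⟨_, _, hn, hn, .refl hc⟩
    · subst hp
      obtain ⟨b, hb, hb'⟩ := step q hq h
      exact ⟨_, b, hn, hb, hb'⟩
    · subst hq
      obtain ⟨b, hb, hb'⟩ := step p hp h.symm
      exact ⟨b, _, hb, hn, hb'.symm⟩
    · obtain ⟨a, b, ha, hb, hab⟩ := hQ.empty p q (hQ.corner_conn_compl_diff hu hr ht h hp hq)
      exact ⟨a, b, ha, hb, hab.mono (Clear.anti Set.sdiff_subset)⟩
end Nice

/-! ### Access from far away -/

/-- Any two positions outside `F` are joined outside `F`. -/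
def ConnCompl (F : Set Pos) : Prop := ∀ p ∉ F, ∀ q ∉ F, Conn Fᶜ p q

theorem ConnCompl.remove {F : Set Pos} (hF : ConnCompl F) {u v : Pos} (hv : v ∉ F)
    (huv : gridGraph.Adj u v) : ConnCompl (F \ {u}) := by
  have hm : Fᶜ ⊆ (F \ {u})ᶜ := Set.compl_subset_compl.2 Set.sdiff_subset
  have key : ∀ p ∉ F \ {u}, Conn (F \ {u})ᶜ p v := fun p hp => by
    by_cases hpu : p = u
    · subst hpu
      exact .single hp (hm hv) huv
    · exact (hF p (fun h => hp ⟨h, hpu⟩) v hv).mono hm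
  exact fun p hp q hq => (key p hp).trans (key q hq).symm

/-- A tile at `p` can move to `q` because `p` and its neighbours are free. -/
def FreeMove (A : Set Pos) (p q : Pos) : Prop :=
  p ∉ A ∧ (∀ r, gridGraph.Adj p r → r ∉ A) ∧ gridGraph.Adj p q

/-- `z` lies outside the box `[-R, R] × [-R, R]`. -/
def Far (R : ℤ) (z : Pos) : Prop := z.1 < -R ∨ R < z.1 ∨ z.2 < -R ∨ R < z.2

/-- A tile can reach `u` from the vicinity of every position that is far away. -/
def Accessible (A : Set Pos) (u : Pos) : Prop :=
  ∃ R : ℤ, ∀ z, Far R z → ∃ p, Near z p ∧ ReflTransGen (FreeMove A) p u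

theorem exists_far_notMem {A : Set Pos} (hA : A.Finite) :
    ∃ R : ℤ, 0 ≤ R ∧ ∀ z, Far R z → z ∉ A := by
  induction A, hA using Set.Finite.induction_on with
  | empty => exact ⟨0, le_rfl, by simp⟩
  | @insert a A _ _ ih =>
    obtain ⟨R, h0, h⟩ := ih
    refine ⟨R + |a.1| + |a.2|, by positivity, fun z hz hza => ?_⟩
    have h1 := abs_nonneg a.1
    have h2 := abs_nonneg a.2
    have h3 := abs_le.1 (le_refl |a.1|)
    have h4 := abs_le.1 (le_refl |a.2|)
    simp only [Far] at h hz
    rcases hza with rfl | hza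
    · omega
    · exact h z (by omega) hza

theorem freeMove_of_conn_clear {F A : Set Pos} (hAF : A ⊆ F) {c d : Pos} (h : Conn (Clear F) c d) :
    ReflTransGen (FreeMove A) c d := by
  refine ReflTransGen.mono (fun a b hab => ?_) _ _ h.2
  refine ⟨fun h => hab.1 a (hAF h) (by simp only [Near]; omega), fun r hr h => hab.1 r (hAF h) ?_,
    hab.2.2⟩
  rw [adj_iff] at hr
  simp only [Near]
  omega

/-- A convex corner can be reached from outside. -/
theorem Nice.accessible_corner {F A : Set Pos} {x y : ℤ} (hF : Nice F) (hfin : F.Finite)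
    (hc : ConnCompl F) (hu : (x, y) ∈ F) (hr : (x + 1, y) ∉ F) (ht : (x, y + 1) ∉ F)
    (hrd : (x + 1, y - 1) ∉ F) (hA : A ⊆ F) (huA : (x, y) ∉ A) : Accessible A (x, y) := by
  obtain ⟨R, _, hR⟩ := exists_far_notMem hfin
  refine ⟨R, fun z hz => ?_⟩
  obtain ⟨b, hb, hb'⟩ := hF.corner_square hu hr ht (hc _ hr _ (hR z hz))
  refine ⟨b, hb, (freeMove_of_conn_clear hA hb'.symm).trans ?_⟩
  have h2 := hb'.left_mem
  have hd := hF.corner_diag hu hr ht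
  have h3 : (x + 2, y + 1) ∉ F := fun h => h2 _ h (by simp only [Near]; omega)
  have h4 : (x + 1, y + 2) ∉ F := fun h => h2 _ h (by simp only [Near]; omega)
  have h5 : (x + 2, y) ∉ F := fun h => h2 _ h (by simp only [Near]; omega)
  -- One step further left the square meets no tile of `F` but `(x, y)`, which `A` lacks.
  have m1 : ReflTransGen (FreeMove A) (x + 2, y + 1) (x + 1, y + 1) :=
    freeMove_of_conn_clear (F := F \ {(x, y)}) (fun p hp => ⟨hA hp, fun h => huA (h ▸ hp)⟩)
      (.single (Clear.anti Set.sdiff_subset h2) (hF.corner_clear hu hr ht) (by simp [adj_iff]; omega))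
  refine m1.trans (.head (b := (x + 1, y)) ?_ (.single ?_))
  · refine ⟨fun h => hd (hA h), fun r hr' h => ?_, by simp [adj_iff]⟩
    rcases adj_cases hr' with rfl | rfl | rfl | rfl
    · exact h3 (by simpa [add_assoc] using hA h)
    · exact ht (by simpa using hA h)
    · exact h4 (by simpa [add_assoc] using hA h)
    · exact hr (by simpa using hA h)
  · refine ⟨fun h => hr (hA h), fun r hr' h => ?_, by simp [adj_iff]⟩
    rcases adj_cases hr' with rfl | rfl | rfl | rfl
    · exact h5 (by simpa [add_assoc] using hA h)
    · exact huA (by simpa using h)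
    · exact hd (by simpa using hA h)
    · exact hrd (by simpa using hA h)

theorem conn_row {A : Set Pos} {y : ℤ} (h : ∀ x, (x, y) ∈ A) (a b : ℤ) : Conn A (a, y) (b, y) := by
  induction b using Int.inductionOn' (b := a) with
  | zero => exact .refl (h a)
  | succ k _ ih => exact ih.trans (.single (h _) (h _) (adj_right _ _))
  | pred k _ ih => exact ih.trans (.single (h _) (h _) (adj_left _ _))

theorem conn_column {A : Set Pos} {x : ℤ} (h : ∀ y, (x, y) ∈ A) (a b : ℤ) :
    Conn A (x, a) (x, b) := by
  induction b using Int.inductionOn' (b := a) with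
  | zero => exact .refl (h a)
  | succ k _ ih => exact ih.trans (.single (h _) (h _) (adj_up _ _))
  | pred k _ ih => exact ih.trans (.single (h _) (h _) (adj_down _ _))

/-- The positions outside a large box are joined to each other. -/
theorem conn_of_far {A : Set Pos} {R : ℤ} (hR : ∀ z, Far R z → z ∈ A) {z : Pos}
    (hz : Far R z) : Conn A (R + 1, R + 1) z := by
  obtain ⟨a, b⟩ := z
  simp only [Far] at hR hz
  by_cases h : a < -R ∨ R < a
  · exact (conn_row (fun x => hR _ (by dsimp only; omega)) _ a).trans
      (conn_column (fun y => hR _ (by dsimp only; omega)) _ _)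
  · exact (conn_column (fun y => hR _ (by dsimp only; omega)) _ b).trans
      (conn_row (fun y => hR _ (by dsimp only; omega)) _ _)

/-! ### Filling the holes -/

/-- `F` arises from `P` by filling all holes. -/
structure Filling (P F : Set Pos) : Prop where
  sub : P ⊆ F
  nice : Nice F
  fin : F.Finite
  compl : ConnCompl F
  hole : ∀ p ∈ F, p ∉ P → ∀ q, gridGraph.Adj p q → q ∈ F

/-- A square that avoids `P` and meets the outside lies entirely outside, so `3`-emptiness is
inherited; a filled position has all its neighbours in `F`, so filling creates no degenerate pair.
-/
theorem Nice.exists_filling {P : Set Pos} (hP : Nice P) (hfin : P.Finite) : ∃ F, Filling P F := by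
  obtain ⟨R, _, hR⟩ := exists_far_notMem hfin
  let b : Pos := (R + 1, R + 1)
  let F : Set Pos := {p | ¬ Conn Pᶜ b p}
  have hF : ∀ {p}, p ∉ F ↔ Conn Pᶜ b p := fun {p} => not_not
  have far : ∀ z, Far R z → z ∉ F := fun z hz => hF.2 (conn_of_far hR hz)
  have sub : P ⊆ F := fun p hp h => h.right_mem hp
  have hole : ∀ p ∈ F, p ∉ P → ∀ q, gridGraph.Adj p q → q ∈ F := fun p hp hpP q hpq hq =>
    hp (hq.trans (.single hq.right_mem hpP hpq.symm))
  refine ⟨F, sub, ⟨?_, fun p hp q hq h1 h2 => ?_, fun p q hpq => ?_⟩, ?_, ?_, hole⟩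
  -- Walking right from a filled position stays in `F` until it meets a tile, which happens before
  -- the far region.
  · have key : ∀ (k : ℕ) (p : Pos), p ∈ F → R < p.1 + k → ∃ r ∈ P, Conn F p r := by
      intro k
      induction k with
      | zero => exact fun p hp hk => absurd hp (far p (by simp only [Far]; omega))
      | succ k ih =>
        rintro ⟨x, y⟩ hp hk
        by_cases hpP : (x, y) ∈ P
        · exact ⟨_, hpP, .refl hp⟩
        · have hq := hole _ hp hpP _ (adj_right x y)
          obtain ⟨r, hr, h⟩ := ih _ hq (by push_cast at hk; dsimp only at hk ⊢; omega)
          exact ⟨r, hr, (Conn.single hp hq (adj_right x y)).trans h⟩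
    intro p hp q hq
    obtain ⟨r, hr, h⟩ := key (R - p.1 + 1).toNat p hp (by omega)
    obtain ⟨r', hr', h'⟩ := key (R - q.1 + 1).toNat q hq (by omega)
    exact (h.trans ((hP.conn r hr r' hr').mono sub)).trans h'.symm
  · by_cases hpP : p ∈ P
    · by_cases hqP : q ∈ P
      · exact (hP.nondeg p hpP q hqP h1 h2).imp (@sub _) (@sub _)
      · exact .inl (hole q hq hqP _ (by rw [adj_iff]; dsimp only; omega))
    · exact .inl (hole p hp hpP _ (by rw [adj_iff]; dsimp only; omega))
  · obtain ⟨c, d, hc, hd, hcd⟩ := hP.empty p q (hpq.mono (Set.compl_subset_compl.2 sub))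
    have key : ∀ c ∈ Clear P, c ∉ F → c ∈ Clear F := fun c hc hcF r hr hrc =>
      hr ((hF.1 hcF).trans (conn_of_near hc hrc))
    refine ⟨c, d, hc, hd, ?_⟩
    have h1 := (hF.1 hpq.left_mem).trans (conn_of_near hcd.left_mem hc).symm
    refine hcd.induct (C := Conn (Clear F) c) (.refl (key c hcd.left_mem (hF.2 h1))) ?_
    intro x y hx hy hxy h
    have hxF : Conn Pᶜ b x := hF.1 (notMem_of_clear h.right_mem (by simp only [Near]; omega))
    refine h.trans (.single h.right_mem (key y hy (hF.2 (hxF.trans (conn_of_near hx ?_)))) hxy)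
    rw [adj_iff] at hxy
    simp only [Near]
    omega
  · refine ((Set.finite_Icc (-R) R).prod (Set.finite_Icc (-R) R)).subset fun p hp => ?_
    have := mt (far p) (not_not.2 hp)
    simp only [Far] at this
    simp only [Set.mem_prod, Set.mem_Icc]
    omega
  · have key : ∀ p ∉ F, Conn Fᶜ b p := fun p hp => by
      have h := hF.1 hp
      refine h.induct (C := Conn Fᶜ b) (.refl (hF.2 (.refl h.left_mem))) fun x y hx hy hxy h => ?_
      exact h.trans (.single h.right_mem (hF.2 ((hF.1 h.right_mem).trans (.single hx hy hxy))) hxy)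
    exact fun p hp q hq => (key p hp).symm.trans (key q hq)

/-! ### Lobes without cut vertices -/

/-- A union `A` of components of `F \ {t}` that avoids `s` and contains no cut vertex of `F`. -/
structure Lobe (F : Set Pos) (s t : Pos) (A : Set Pos) : Prop where
  sub : A ⊆ F
  nonempty : A.Nonempty
  mem : t ∈ F
  notMem : t ∉ A
  seed_notMem : s ∉ A
  closed : ∀ a ∈ A, ∀ b ∈ F, gridGraph.Adj a b → b ∈ A ∨ b = t
  noncut : ∀ u ∈ A, ∀ p ∈ F \ {u}, ∀ q ∈ F \ {u}, Conn (F \ {u}) p q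

/-- Descent on the size of `A`, beginning with `F \ {s}` attached at `s`. If some `u ∈ A` cuts `F`,
the tiles that it separates from `t` lie in `A`, miss `u` and are attached at `u`: a smaller
candidate. -/
theorem exists_lobe {F : Set Pos} (hF : ∀ p ∈ F, ∀ q ∈ F, Conn F p q) (hfin : F.Finite) {s v : Pos}
    (hs : s ∈ F) (hv : v ∈ F) (hvs : v ≠ s) : ∃ t A, Lobe F s t A := by
  suffices key : ∀ (n : ℕ) (t : Pos) (A : Set Pos), A.ncard = n → A ⊆ F → A.Nonempty → t ∈ F →
      t ∉ A → s ∉ A → (∀ a ∈ A, ∀ b ∈ F, gridGraph.Adj a b → b ∈ A ∨ b = t) →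
      ∃ t A, Lobe F s t A by
    refine key _ s (F \ {s}) rfl Set.sdiff_subset ⟨v, hv, hvs⟩ hs (by simp) (by simp) ?_
    intro a _ b hb _
    by_cases h : b = s
    · exact .inr h
    · exact .inl ⟨hb, h⟩
  intro n
  induction n using Nat.strong_induction_on with
  | _ n ih =>
  intro t A hn hA hne ht htA hsA hcl
  by_cases hcut : ∀ u ∈ A, ∀ p ∈ F \ {u}, Conn (F \ {u}) t p
  · exact ⟨t, A, hA, hne, ht, htA, hsA, hcl, fun u hu p hp q hq =>
      (hcut u hu p hp).symm.trans (hcut u hu q hq)⟩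
  push Not at hcut
  obtain ⟨u, hu, p, hp, hpc⟩ := hcut
  have hjoin : ∀ z ∈ F, z ∉ A → Conn (F \ A) t z := by
    intro z hz
    refine (hF t ht z hz).induct (C := fun z => z ∉ A → Conn (F \ A) t z)
      (fun _ => .refl ⟨ht, htA⟩) fun a b ha hb hab h hbA => ?_
    by_cases haA : a ∈ A
    · obtain h | rfl := hcl a haA b hb hab
      · exact absurd h hbA
      · exact .refl ⟨hb, hbA⟩
    · exact (h haA).trans (.single ⟨ha, haA⟩ ⟨hb, hbA⟩ hab)
  let C : Set Pos := {z | z ∈ F \ {u} ∧ ¬ Conn (F \ {u}) t z}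
  have hCA : C ⊆ A := fun z hz => by
    by_contra hzA
    exact hz.2 ((hjoin z hz.1.1 hzA).mono fun w hw => ⟨hw.1, fun h => hw.2 (h ▸ hu)⟩)
  have huC : u ∉ C := fun h => h.1.2 rfl
  refine ih C.ncard ?_ u C rfl (hCA.trans hA) ⟨p, hp, hpc⟩ (hA hu) huC (fun h => hsA (hCA h)) ?_
  · rw [← hn]
    exact Set.ncard_lt_ncard ⟨hCA, fun h => huC (h hu)⟩ (hfin.subset hA)
  · intro a ha b hb hab
    by_cases hbu : b = u
    · exact .inr hbu
    · exact .inl ⟨⟨hb, hbu⟩, fun h => ha.2 (h.trans (.single ⟨hb, hbu⟩ ha.1 hab.symm))⟩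

/-! ### Parity around a hole -/

/-- Encodes that every grid edge lies in exactly two `2 × 2` blocks. -/
theorem finsum_add_shift (f : Pos → ZMod 2) (hf : f.support.Finite) (w : Pos) :
    (f + fun z => f (z + w)).support.Finite ∧ ∑ᶠ z, (f z + f (z + w)) = 0 := by
  have h2 : (Function.support fun z => f (z + w)).Finite :=
    hf.preimage (f := fun z => z + w) (add_left_injective w).injOn
  refine ⟨(hf.union h2).subset (Function.support_add _ _), ?_⟩
  have h3 : ∑ᶠ z, f (z + w) = ∑ᶠ z, f z := finsum_comp_equiv (Equiv.addRight w)
  rw [finsum_add_distrib hf h2, h3]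
  exact CharTwo.add_self_eq_zero _

/-- Otherwise let `C` be the component of the left neighbour after the removal and `H` the hole. The
number of adjacent pairs between `C` and `H` is even in every `2 × 2` block except the one with
lower left position `(x - 1, y - 1)`, which has exactly one. But the sum over all blocks counts each
pair twice. -/
theorem Nice.conn_of_hole {P : Set Pos} (hP : Nice P) (hfin : P.Finite) {x y : ℤ}
    (hu : (x, y) ∈ P) (hl : (x - 1, y) ∈ P) (hd : (x, y - 1) ∈ P) (hx : (x - 1, y - 1) ∉ P)
    (hr : (x + 1, y) ∉ P) (ht : (x, y + 1) ∉ P)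
    (hrH : ¬ Conn Pᶜ (x - 1, y - 1) (x + 1, y)) (htH : ¬ Conn Pᶜ (x - 1, y - 1) (x, y + 1)) :
    Conn (P \ {(x, y)}) (x - 1, y) (x, y - 1) := by
  classical
  by_contra hcon
  let C : Set Pos := {p | Conn (P \ {(x, y)}) (x - 1, y) p}
  let H : Set Pos := {p | Conn Pᶜ (x - 1, y - 1) p}
  have hCfin : C.Finite := hfin.subset fun p hp => hp.right_mem.1
  have CP : ∀ p ∈ C, p ∈ P := fun p hp => hp.right_mem.1
  have HP : ∀ p ∈ H, p ∉ P := fun p hp => hp.right_mem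
  have CC : ∀ p q, gridGraph.Adj p q → p ∈ C → q ∈ P → q ≠ (x, y) → q ∈ C :=
    fun p q h hp hq hqu => hp.trans (.single hp.right_mem ⟨hq, hqu⟩ h)
  have HH : ∀ p q, gridGraph.Adj p q → p ∈ H → q ∉ P → q ∈ H :=
    fun p q h hp hq => hp.trans (.single hp.right_mem hq h)
  have hlC : (x - 1, y) ∈ C := .refl ⟨hl, by simp⟩
  have hxH : (x - 1, y - 1) ∈ H := .refl hx
  let e : Pos → Pos → ZMod 2 := fun p q => if p ∈ C ∧ q ∈ H ∨ p ∈ H ∧ q ∈ C then 1 else 0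
  have e0 : ∀ p q, p ∉ C → p ∉ H → e p q = 0 := fun p q h1 h2 => if_neg (by tauto)
  have e0' : ∀ p q, p ∉ C → p ∉ H → e q p = 0 := fun p q h1 h2 => if_neg (by tauto)
  have esupp : ∀ w : Pos, (Function.support fun z => e z (z + w)).Finite := fun w => by
    refine (hCfin.union (hCfin.preimage (f := fun z => z + w) (add_left_injective w).injOn)).subset ?_
    intro z hz
    rw [Function.mem_support] at hz
    by_contra h
    exact hz (if_neg fun h' => h (h'.imp (·.1) (·.2)))
  have block : ∀ i j : ℤ, e (i, j) (i + 1, j) + e (i, j + 1) (i + 1, j + 1) +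
      (e (i, j) (i, j + 1) + e (i + 1, j) (i + 1, j + 1)) =
      if (i, j) = (x - 1, y - 1) then 1 else 0 := by
    intro i j
    have rN : (x + 1, y) ∉ C ∧ (x + 1, y) ∉ H := ⟨fun h => hr (CP _ h), hrH⟩
    have tN : (x, y + 1) ∉ C ∧ (x, y + 1) ∉ H := ⟨fun h => ht (CP _ h), htH⟩
    have dN : (x, y - 1) ∉ C ∧ (x, y - 1) ∉ H := ⟨hcon, fun h => HP _ h hd⟩
    have uN : (x, y) ∉ C ∧ (x, y) ∉ H := ⟨fun h => h.right_mem.2 rfl, fun h => HP _ h hu⟩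
    by_cases ha : (i, j) = (x, y)
    · obtain ⟨rfl, rfl⟩ := Prod.mk.inj ha
      rw [e0 _ _ uN.1 uN.2, e0 _ _ uN.1 uN.2, e0 _ _ tN.1 tN.2, e0 _ _ rN.1 rN.2,
        if_neg (by simp; omega)]
      simp
    by_cases hb : (i + 1, j) = (x, y)
    · obtain ⟨rfl, rfl⟩ := Prod.mk.inj hb
      rw [add_sub_cancel_right] at hlC
      have hc : (i, j + 1) ∉ H := fun h => tN.2 (HH _ _ (adj_right _ _) h ht)
      rw [e0' _ _ uN.1 uN.2, e0 _ _ uN.1 uN.2, e0' _ _ tN.1 tN.2, if_neg (by simp; omega)]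
      have h : (i, j) ∉ H := fun h => HP _ h (CP _ hlC)
      simp [e, hc, h]
    by_cases hc : (i, j + 1) = (x, y)
    · obtain ⟨rfl, rfl⟩ := Prod.mk.inj hc
      rw [add_sub_cancel_right] at dN
      rw [e0 _ _ dN.1 dN.2, e0 _ _ dN.1 dN.2, e0 _ _ uN.1 uN.2, e0' _ _ rN.1 rN.2,
        if_neg (by simp; omega)]
      simp
    by_cases hd' : (i + 1, j + 1) = (x, y)
    · obtain ⟨rfl, rfl⟩ := Prod.mk.inj hd'
      rw [add_sub_cancel_right] at dN
      simp only [add_sub_cancel_right] at hlC hxH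
      rw [e0' _ _ dN.1 dN.2, e0' _ _ uN.1 uN.2, e0' _ _ uN.1 uN.2]
      simp [e, hlC, hxH]
    rw [if_neg (by rintro h; obtain ⟨rfl, rfl⟩ := Prod.mk.inj h; simp at hd')]
    -- In a block without `(x, y)`, non-degeneracy joins the tiles to each other and the free
    -- positions to each other, so the four cyclic edges change sides evenly often.
    have n1 := fun h h' => hP.nondeg (i, j) h (i + 1, j + 1) h' (by simp) (by simp)
    have n2 := fun h h' => hP.nondeg (i + 1, j) h (i, j + 1) h' (by simp) (by simp)
    dsimp only at n1 n2
    have ab := adj_right i j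
    have cd := adj_right i (j + 1)
    have ac := adj_up i j
    have bd := adj_up (i + 1) j
    simp only [e]
    generalize ((i, j) : Pos) = a at *
    generalize ((i + 1, j) : Pos) = b at *
    generalize ((i, j + 1) : Pos) = c at *
    generalize ((i + 1, j + 1) : Pos) = d at *
    have a1 := CP a; have a2 := HP a
    have b1 := CP b; have b2 := HP b
    have c1 := CP c; have c2 := HP c
    have d1 := CP d; have d2 := HP d
    have ab1 := CC a b ab; have ab2 := HH a b ab; have ab3 := CC b a ab.symm; have ab4 := HH b a ab.symm
    have cd1 := CC c d cd; have cd2 := HH c d cd; have cd3 := CC d c cd.symm; have cd4 := HH d c cd.symm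
    have ac1 := CC a c ac; have ac2 := HH a c ac; have ac3 := CC c a ac.symm; have ac4 := HH c a ac.symm
    have bd1 := CC b d bd; have bd2 := HH b d bd; have bd3 := CC d b bd.symm; have bd4 := HH d b bd.symm
    clear CP HP CC HH e0 e0' esupp rN tN dN uN hcon hrH htH hlC hxH hCfin hP hfin
    clear e
    clear ab ac bd cd hu hl hd hx hr ht
    have two : (1 : ZMod 2) + 1 = 0 := by decide
    by_cases pa : a ∈ P <;> by_cases pb : b ∈ P <;> by_cases pc : c ∈ P <;> by_cases pd : d ∈ P <;>
      simp only [pa, pb, pc, pd] at * <;> grind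
  have f1 := finsum_add_shift (fun z => e z (z + (1, 0))) (esupp _) (0, 1)
  have f2 := finsum_add_shift (fun z => e z (z + (0, 1))) (esupp _) (1, 0)
  have f3 := finsum_add_distrib f1.1 f2.1
  simp only [Pi.add_apply] at f3
  rw [f1.2, f2.2, finsum_eq_single _ (x - 1, y - 1)] at f3
  · have := block (x - 1) (y - 1)
    simp at f3 this
    rw [this] at f3
    simp at f3
  · rintro ⟨i, j⟩ hz
    have := block i j
    rw [if_neg hz] at this
    simpa using this

/-! ### Assembly in the unbounded plane and walls of holes -/

/-- The sets that can be assembled from the seed `s` in an unbounded workspace. -/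
inductive Assembly (s : Pos) : Set Pos → Prop
  | seed : Assembly s {s}
  | step (A : Set Pos) (q : Pos) (hA : Assembly s A) (hq : q ∉ A) (hacc : Accessible A q)
      (hadj : ∃ r ∈ A, gridGraph.Adj q r) : Assembly s (insert q A)

theorem Assembly.of_diff {s u : Pos} {Q : Set Pos} (h : Assembly s (Q \ {u})) (hu : u ∈ Q)
    (hsu : s ∈ Q \ {u}) (hQ : Conn Q u s) (hacc : Accessible (Q \ {u}) u) : Assembly s Q := by
  obtain ⟨r, hr, hur⟩ := exists_adj_of_conn hQ (Ne.symm hsu.2)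
  have := Assembly.step _ u h (by simp) hacc ⟨r, ⟨hr, hur.ne'⟩, hur⟩
  rwa [Set.insert_sdiff_singleton, Set.insert_eq_of_mem hu] at this

theorem conn_remove_leaf {Q : Set Pos} {u v : Pos} (hQ : ∀ p ∈ Q, ∀ q ∈ Q, Conn Q p q)
    (h : ∀ a ∈ Q, gridGraph.Adj u a → a = v) :
    ∀ p ∈ Q \ {u}, ∀ q ∈ Q \ {u}, Conn (Q \ {u}) p q := by
  refine fun p hp q hq => (hQ p hp.1 q hq.1).diff hp.2 hq.2 fun a ha b hb hua hub => ?_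
  rw [h a ha hua, h b hb hub, ← h a ha hua]
  exact .refl ⟨ha, hua.ne'⟩

theorem Filling.mem_of_conn {P F : Set Pos} (h : Filling P F) {p q : Pos} (hp : p ∈ F)
    (hpq : Conn Pᶜ p q) : q ∈ F :=
  hpq.induct (C := (· ∈ F)) hp fun x _ hx _ hxy hxF => h.hole x hxF hx _ hxy

/-- The tile `(x, y)` is a convex corner of `P` whose lower left position belongs to a hole, and
the right neighbours of the four tiles below and including the corner are outside. -/
structure HoleCorner (P F : Set Pos) (x y : ℤ) : Prop where
  left : (x - 1, y) ∈ P
  top : (x, y + 1) ∉ F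
  hole_notMem : (x - 1, y - 1) ∉ P
  hole_mem : (x - 1, y - 1) ∈ F
  mem : ∀ k, 0 ≤ k → k ≤ 3 → (x, y - k) ∈ P
  right : ∀ k, 0 ≤ k → k ≤ 4 → (x + 1, y - k) ∉ F

/-- The square inside the hole next to a convex corner. -/
theorem Nice.hole_square {P : Set Pos} (hP : Nice P) {x y : ℤ} (hl : (x - 1, y) ∈ P)
    (hd : (x, y - 1) ∈ P) {q : Pos} (hq : Conn Pᶜ (x - 1, y - 1) q) :
    ∃ b, Near q b ∧ Conn (Clear P) (x - 2, y - 2) b := by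
  obtain ⟨⟨a1, a2⟩, b, ha, hb, hab⟩ := hP.empty _ _ hq
  have h1 := hab.left_mem _ hl
  have h2 := hab.left_mem _ hd
  simp only [Near] at ha h1 h2
  obtain rfl : a1 = x - 2 := by omega
  obtain rfl : a2 = y - 2 := by omega
  exact ⟨b, hb, hab⟩

namespace HoleCorner
variable {P F : Set Pos} {x y : ℤ}

theorem clear (h : HoleCorner P F x y) (hP : Nice P) : (x - 2, y - 2) ∈ Clear P := by
  obtain ⟨_, _, hb⟩ := hP.hole_square h.left (h.mem 1 (by omega) (by omega))
    (Conn.refl h.hole_notMem)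
  exact hb.left_mem

theorem conn_hole (h : HoleCorner P F x y) (hP : Nice P) {q : Pos} (hq : Near q (x - 2, y - 2)) :
    Conn Pᶜ (x - 1, y - 1) q :=
  (conn_of_near (h.clear hP) (by simp only [Near]; omega)).symm.trans (conn_of_near (h.clear hP) hq)

theorem mem_hole (h : HoleCorner P F x y) (hP : Nice P) (hF : Filling P F) {q : Pos}
    (hq : Near q (x - 2, y - 2)) : q ∈ F :=
  hF.mem_of_conn h.hole_mem (h.conn_hole hP hq)

/-- The tiles adjacent to the column of the corner. -/
theorem adj_column (h : HoleCorner P F x y) (hP : Nice P) (hF : Filling P F) {k : ℤ} (h0 : 0 ≤ k)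
    (h3 : k ≤ 3) {a : Pos} (ha : a ∈ P) (hka : gridGraph.Adj (x, y - k) a) :
    (a = (x - 1, y) ∧ k = 0) ∨ (a = (x, y - k + 1) ∧ k ≠ 0) ∨ a = (x, y - k - 1) := by
  rcases adj_cases hka with rfl | rfl | rfl | rfl
  · exact absurd (hF.sub ha) (h.right k h0 (by omega))
  · by_cases hk : k = 0
    · subst hk; simp
    · exact absurd ha (h.conn_hole hP (by simp only [Near]; omega)).right_mem
  · by_cases hk : k = 0
    · subst hk; exact absurd (hF.sub ha) (by simpa using h.top)
    · simp [hk]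
  · simp

/-- The set `Q` without the topmost `k` tiles of the column of the corner. -/
def cut (Q : Set Pos) (x y : ℤ) (k : ℤ) : Set Pos := {p ∈ Q | ¬ (p.1 = x ∧ y - k < p.2 ∧ p.2 ≤ y)}

theorem cut_zero (Q : Set Pos) (x y : ℤ) : cut Q x y 0 = Q := by
  ext p; simp only [cut, Set.mem_ofPred_eq]; constructor
  · exact And.left
  · exact fun h => ⟨h, by omega⟩

theorem cut_succ (Q : Set Pos) (x y : ℤ) {k : ℤ} (hk : 0 ≤ k) :
    cut Q x y (k + 1) = cut Q x y k \ {(x, y - k)} := by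
  ext ⟨a, b⟩
  simp only [cut, Set.mem_ofPred_eq, Set.mem_sdiff, Set.mem_singleton_iff, Prod.mk.injEq, and_assoc]
  refine and_congr_right fun _ => ?_
  omega

theorem cut_subset (Q : Set Pos) (x y k : ℤ) : cut Q x y k ⊆ Q := fun _ h => h.1

theorem mem_cut_column {Q : Set Pos} {x y k : ℤ} (h : (x, y - k) ∈ Q) : (x, y - k) ∈ cut Q x y k :=
  ⟨h, by dsimp only; omega⟩

theorem notMem_cut {Q : Set Pos} {x y k : ℤ} {q : Pos} (h : q ∉ Q) : q ∉ cut Q x y k :=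
  fun h' => h h'.1

/-- Removing the topmost tiles of the column from the filled set. -/
theorem nice_cut_filling (h : HoleCorner P F x y) (hP : Nice P) (hF : Filling P F) (k : ℕ)
    (hk : k ≤ 3) : Nice (cut F x y k) ∧ ConnCompl (cut F x y k) ∧ (x, y - k + 1) ∉ cut F x y k := by
  induction k with
  | zero =>
    simp only [Nat.cast_zero, cut_zero, sub_zero]
    exact ⟨hF.nice, hF.compl, h.top⟩
  | succ k ih =>
    obtain ⟨h1, h2, h3⟩ := ih (by omega)
    have hr : (x + 1, y - k) ∉ cut F x y k := notMem_cut (h.right k (by omega) (by omega))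
    have hu := mem_cut_column (hF.sub (h.mem k (by omega) (by omega)))
    rw [Nat.cast_succ, cut_succ _ _ _ (by omega)]
    -- The diagonal position lies in the clear square of the hole, whose rows are `y - 3` to `y -
    -- 1`; hence the bound `3`.
    refine ⟨h1.remove_corner hu hr h3 fun _ _ => ?_, h2.remove hr (adj_right _ _), ?_⟩
    · exact ⟨h.mem_hole hP hF (by simp only [Near]; omega), by dsimp only; omega⟩
    · rw [show y - (k + 1 : ℤ) + 1 = y - k by ring]
      exact fun h => h.2 rfl

/-- Removing the topmost tiles of the column keeps the tiles connected. -/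
theorem conn_cut (h : HoleCorner P F x y) (hP : Nice P) (hfin : P.Finite) (hF : Filling P F) (k : ℕ)
    (hk : k ≤ 4) : ∀ p ∈ cut P x y k, ∀ q ∈ cut P x y k, Conn (cut P x y k) p q := by
  induction k with
  | zero => simpa only [Nat.cast_zero, cut_zero] using hP.conn
  | succ k ih =>
    rw [Nat.cast_succ, cut_succ _ _ _ (by omega)]
    obtain rfl | hk0 := Nat.eq_zero_or_pos k
    · simp only [Nat.cast_zero, cut_zero, sub_zero]
      have h0 := h.mem 0 (by omega) (by omega)
      have h1 := h.mem 1 (by omega) (by omega)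
      have hr := h.right 0 (by omega) (by omega)
      rw [sub_zero] at h0 hr
      have key := hP.conn_of_hole hfin h0 h.left h1 h.hole_notMem (fun h => hr (hF.sub h))
        (fun h' => h.top (hF.sub h')) (fun h' => hr (hF.mem_of_conn h.hole_mem h'))
        (fun h' => h.top (hF.mem_of_conn h.hole_mem h'))
      refine fun p hp q hq => (hP.conn p hp.1 q hq.1).diff hp.2 hq.2 fun a ha b hb hua hub => ?_
      rw [← sub_zero y] at hua hub
      have ha' := h.adj_column hP hF le_rfl (by omega) ha hua
      have hb' := h.adj_column hP hF le_rfl (by omega) hb hub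
      simp only [ne_eq, not_true_eq_false, and_false, false_or, and_true, sub_zero] at ha' hb'
      obtain rfl | rfl := ha' <;> obtain rfl | rfl := hb'
      · exact .refl key.left_mem
      · exact key
      · exact key.symm
      · exact .refl key.right_mem
    -- With the hole on its left and the outside on its right, the new top of the column is a leaf.
    · refine conn_remove_leaf (v := (x, y - k - 1)) (ih (by omega)) fun a ha hka => ?_
      rcases h.adj_column hP hF (by omega) (by omega) ha.1 hka with h' | ⟨rfl, _⟩ | h'
      · omega
      · exact absurd ⟨rfl, by dsimp only; omega, by dsimp only; omega⟩ ha.2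
      · exact h'

/-- The gap spans the rows `y - 3` to `y - 1`, through which the square of the hole slides from
centre `(x - 2, y - 2)` to `(x + 1, y - 2)`. There it is clear because `(x, y - 3)` is a convex
corner of `cut F x y 3`. The hole merges with the outside; other holes are untouched. -/
theorem nice_cut (h : HoleCorner P F x y) (hP : Nice P) (hfin : P.Finite) (hF : Filling P F) :
    Nice (cut P x y 4) := by
  obtain ⟨n3, c3, t3⟩ := h.nice_cut_filling hP hF 3 le_rfl
  simp only [Nat.cast_ofNat] at n3 c3 t3
  have u3 : (x, y - 3) ∈ cut F x y 3 := mem_cut_column (hF.sub (h.mem 3 (by omega) (by omega)))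
  have r3 : (x + 1, y - 3) ∉ cut F x y 3 := notMem_cut (h.right 3 (by omega) (by omega))
  have e4 : cut F x y 3 \ {(x, y - 3)} = cut F x y 4 := (cut_succ F x y (k := 3) (by omega)).symm
  have hsub : cut P x y 4 ⊆ cut F x y 4 := fun p hp => ⟨hF.sub hp.1, hp.2⟩
  have column : ∀ p, p ∉ cut P x y 4 → p ∈ P → ∃ k, 0 ≤ k ∧ k ≤ 3 ∧ p = (x, y - k) := by
    rintro ⟨a, b⟩ hp hpP
    have : a = x ∧ y - 4 < b ∧ b ≤ y := by
      by_contra hc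
      exact hp ⟨hpP, hc⟩
    exact ⟨y - b, by omega, by omega, by simp [this.1]⟩
  have column' : ∀ p, p ∉ cut F x y 4 → p ∈ F → ∃ k, 0 ≤ k ∧ k ≤ 3 ∧ p = (x, y - k) := by
    rintro ⟨a, b⟩ hp hpF
    have : a = x ∧ y - 4 < b ∧ b ≤ y := by
      by_contra hc
      exact hp ⟨hpF, hc⟩
    exact ⟨y - b, by omega, by omega, by simp [this.1]⟩
  refine ⟨h.conn_cut hP hfin hF 4 le_rfl, fun p hp q hq h1 h2 => ?_, ?_⟩
  · have key : ∀ c ∈ P, gridGraph.Adj c p → gridGraph.Adj c q → c ∈ cut P x y 4 := by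
      intro c hc hcp hcq
      by_contra hcn
      obtain ⟨k, h0, h3, rfl⟩ := column c hcn hc
      have hp' := hp.2
      have hq' := hq.2
      have e1 := h.adj_column hP hF h0 h3 hp.1 hcp
      have e2 := h.adj_column hP hF h0 h3 hq.1 hcq
      simp only [Prod.ext_iff] at e1 e2
      omega
    exact (hP.nondeg p hp.1 q hq.1 h1 h2).imp
      (fun h => key _ h (by rw [adj_iff]; dsimp only; omega) (by rw [adj_iff]; dsimp only; omega))
      (fun h => key _ h (by rw [adj_iff]; dsimp only; omega) (by rw [adj_iff]; dsimp only; omega))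
  · have cl0 : (x - 2, y - 2) ∈ Clear (cut P x y 4) := Clear.anti (cut_subset _ _ _ _) (h.clear hP)
    have cl3 : (x + 1, y - 2) ∈ Clear (cut P x y 4) := by
      refine Clear.anti hsub ?_
      have := n3.corner_clear u3 r3 t3
      rwa [e4, show y - 3 + 1 = y - 2 by ring] at this
    have cl1 : (x - 1, y - 2) ∈ Clear (cut P x y 4) := fun p hp hn => by
      have i0 := cl0 p hp
      have := hp.2
      simp only [Near] at i0 hn
      omega
    have cl2 : (x, y - 2) ∈ Clear (cut P x y 4) := fun p hp hn => by
      have i0 := cl0 p hp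
      have i3 := cl3 p hp
      have := hp.2
      simp only [Near] at i0 i3 hn
      omega
    have slide : Conn (Clear (cut P x y 4)) (x - 2, y - 2) (x + 1, y - 2) :=
      ((Conn.single cl0 cl1 (by simp [adj_iff]; omega)).trans
        (.single cl1 cl2 (by simp [adj_iff]))).trans (.single cl2 cl3 (by simp [adj_iff]))
    have reach : ∀ q, (q ∉ cut F x y 4 ∨ Conn Pᶜ (x - 1, y - 1) q) →
        ∃ b, Near q b ∧ Conn (Clear (cut P x y 4)) (x - 2, y - 2) b := by
      rintro q (hq | hq)
      · by_cases hq3 : q = (x, y - 3)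
        · subst hq3
          exact ⟨_, by simp only [Near]; omega, slide⟩
        · obtain ⟨b, hb, hb'⟩ := n3.corner_square_diff u3 r3 t3
            (c3 _ r3 q fun h => hq (e4 ▸ ⟨h, hq3⟩))
          rw [e4, show y - 3 + 1 = y - 2 by ring] at hb'
          exact ⟨b, hb, slide.trans (hb'.mono (Clear.anti hsub))⟩
      · obtain ⟨b, hb, hb'⟩ := hP.hole_square h.left (h.mem 1 (by omega) (by omega)) hq
        exact ⟨b, hb, hb'.mono (Clear.anti (cut_subset _ _ _ _))⟩
    -- The outside and the opened hole together form a union of components of the free positions.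
    have spread : ∀ p q, p ∉ cut P x y 4 → q ∉ cut P x y 4 → gridGraph.Adj p q →
        (p ∉ cut F x y 4 ∨ Conn Pᶜ (x - 1, y - 1) p) →
        (q ∉ cut F x y 4 ∨ Conn Pᶜ (x - 1, y - 1) q) := by
      intro p q hp hq hpq hpb
      by_contra! hqb
      have hqF : q ∈ F := hqb.1.1
      have hqP : q ∉ P := fun h => hq ⟨h, hqb.1.2⟩
      rcases hpb with hpb | hpb
      · obtain ⟨k, h0, h3, rfl⟩ := column' p hpb (hF.hole q hqF hqP _ hpq.symm)
        rcases adj_cases hpq with rfl | rfl | rfl | rfl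
        · exact h.right k h0 (by omega) hqF
        · by_cases hk : k = 0
          · subst hk; exact hqP (by simpa using h.left)
          · exact hqb.2 (h.conn_hole hP (by simp only [Near]; omega))
        · by_cases hk : k = 0
          · subst hk; exact h.top (by simpa using hqF)
          · exact hqP (by
              have := h.mem (k - 1) (by omega) (by omega)
              rwa [show y - (k - 1) = y - k + 1 by ring] at this)
        · refine h.right (k + 1) (by omega) (by omega) (hF.hole _ hqF hqP _ ?_)
          rw [← sub_sub]
          exact adj_right _ _
      · exact hqb.2 (hpb.trans (.single hpb.right_mem hqP hpq))
    intro p q hpq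
    by_cases hpb : p ∉ cut F x y 4 ∨ Conn Pᶜ (x - 1, y - 1) p
    · have hqb := hpq.induct (C := fun q => q ∉ cut F x y 4 ∨ Conn Pᶜ (x - 1, y - 1) q) hpb
        fun a b ha hb hab h => spread a b ha hb hab h
      obtain ⟨a, ha, ha'⟩ := reach p hpb
      obtain ⟨b, hb, hb'⟩ := reach q hqb
      exact ⟨a, b, ha, hb, ha'.symm.trans hb'⟩
    · have free : ∀ z, z ∉ cut P x y 4 → ¬ (z ∉ cut F x y 4 ∨ Conn Pᶜ (x - 1, y - 1) z) → z ∉ P :=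
        fun z hz hzb hzP => hzb (.inl fun hzF => hz ⟨hzP, hzF.2⟩)
      have := hpq.induct (C := fun z => ¬ (z ∉ cut F x y 4 ∨ Conn Pᶜ (x - 1, y - 1) z) ∧ Conn Pᶜ p z)
        ⟨hpb, .refl (free p hpq.left_mem hpb)⟩ (by
          rintro a b ha hb hab ⟨h1, h2⟩
          have hbb := mt (spread b a hb ha hab.symm) h1
          exact ⟨hbb, h2.trans (.single (free a ha h1) (free b hb hbb) hab)⟩)
      obtain ⟨a, b, ha, hb, hab⟩ := hP.empty p q this.2
      exact ⟨a, b, ha, hb, hab.mono (Clear.anti (cut_subset _ _ _ _))⟩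

/-- The tiles return from the bottom up and always from outside: access is checked against `cut F x
y k`, which is `Nice` even where `cut P x y k` may fail to be. -/
theorem assembly (h : HoleCorner P F x y) (hP : Nice P) (hfin : P.Finite) (hF : Filling P F) {s : Pos}
    (hs : s ∈ cut P x y 4) (hA : Assembly s (cut P x y 4)) : Assembly s P := by
  have key : ∀ k : ℕ, k ≤ 4 → Assembly s (cut P x y k) → Assembly s (cut P x y 0) := by
    intro k
    induction k with
    | zero => exact fun _ h => h
    | succ k ih =>
      intro hk hA
      refine ih (by omega) ?_
      rw [Nat.cast_succ, cut_succ _ _ _ (by omega)] at hA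
      obtain ⟨n, c, t⟩ := h.nice_cut_filling hP hF k (by omega)
      have hu : (x, y - k) ∈ cut P x y k := mem_cut_column (h.mem k (by omega) (by omega))
      have hsk : s ∈ cut P x y k := ⟨hs.1, fun h' => hs.2 ⟨h'.1, by omega, h'.2.2⟩⟩
      have hsu : s ≠ (x, y - k) := fun h' => hs.2 (by rw [h']; dsimp only; omega)
      have hsub : cut P x y k ⊆ cut F x y k := fun p hp => ⟨hF.sub hp.1, hp.2⟩
      have hrd := h.right (k + 1) (by omega) (by omega)
      rw [← sub_sub] at hrd
      exact hA.of_diff hu ⟨hsk, hsu⟩ (h.conn_cut hP hfin hF k (by omega) _ hu _ hsk)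
        (n.accessible_corner (hF.fin.subset (cut_subset _ _ _ _)) c (hsub hu)
          (notMem_cut (h.right k (by omega) (by omega))) t (notMem_cut hrd)
          (Set.sdiff_subset.trans hsub) (by simp))
  simpa only [cut_zero] using key 4 le_rfl hA

end HoleCorner

/-! ### The removal step and its rotations -/

/-- If a lobe contains a tile to the right of its attachment, then some tiles of the lobe can be
removed. -/
theorem assembly_of_lobe_right {P F A : Set Pos} {s t : Pos} (hP : Nice P) (hfin : P.Finite)
    (hF : Filling P F) (hs : s ∈ P) (hA : Lobe F s t A)
    (ih : ∀ Q, Q ⊂ P → s ∈ Q → Nice Q → Assembly s Q) (ht : ∃ a ∈ A, t.1 < a.1) :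
    Assembly s P := by
  have hAfin := hF.fin.subset hA.sub
  -- The last column of the lobe lies strictly right of `t`, so `t` cannot be a position of `F`
  -- above this column or to its right.
  obtain ⟨⟨x, y'⟩, hxA, hx⟩ := Set.exists_max_image A Prod.fst hAfin hA.nonempty
  obtain ⟨⟨x', y⟩, ⟨huA, rfl⟩, hy⟩ := Set.exists_max_image {a ∈ A | a.1 = x} Prod.snd
    (hAfin.subset fun a ha => ha.1) ⟨_, hxA, rfl⟩
  obtain ⟨a, haA, hta⟩ := ht
  have htx : t.1 < x' := hta.trans_le (hx a haA)
  have hright : ∀ z, (x', z) ∈ A → (x' + 1, z) ∉ F := fun z hz h => by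
    rcases hA.closed _ hz _ h (adj_right _ _) with h | rfl
    · have := hx _ h
      dsimp only at this
      omega
    · dsimp only at htx
      omega
  have hdown : ∀ z, (x', z) ∈ A → (x', z - 1) ∈ F → (x', z - 1) ∈ A := fun z hz h => by
    rcases hA.closed _ hz _ h (adj_down _ _) with h | rfl
    · exact h
    · exact absurd htx (lt_irrefl _)
  have hrd : ∀ z, (x', z) ∈ A → (x' + 1, z - 1) ∉ F := fun z hz h => by
    rcases hF.nice.nondeg _ (hA.sub hz) _ h (by simp) (by simp) with h' | h'
    · exact hright _ (hdown z hz h') h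
    · exact hright z hz h'
  have htile : ∀ z, (x', z) ∈ A → (x', z) ∈ P := fun z hz => by
    by_contra h
    exact hright z hz (hF.hole _ (hA.sub hz) h _ (adj_right _ _))
  have htop : (x', y + 1) ∉ F := fun h => by
    rcases hA.closed _ huA _ h (adj_up _ _) with h | rfl
    · have := hy _ ⟨h, rfl⟩
      dsimp only at this
      omega
    · exact absurd htx (lt_irrefl _)
  have hu := htile y huA
  have hsu : s ∈ P \ {(x', y)} := ⟨hs, fun h => hA.seed_notMem (h ▸ huA)⟩
  -- A free diagonal position would make the corner a cut vertex of `F`.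
  have hcorner : (x' - 1, y) ∈ F → (x', y - 1) ∈ F → (x' - 1, y - 1) ∈ F := fun h1 h2 => by
    by_contra h3
    exact not_conn_of_cut_corner htop h1 h2 (hF.compl _ h3 _ htop)
      (hA.noncut _ huA _ ⟨h1, by simp⟩ _ ⟨h2, by simp⟩)
  by_cases hb : (x' - 1, y) ∈ P → (x', y - 1) ∈ P → (x' - 1, y - 1) ∈ P
  · have hN := hP.remove_corner hu (fun h => hright y huA (hF.sub h)) (fun h => htop (hF.sub h)) hb
    exact (ih (P \ {(x', y)}) ⟨Set.sdiff_subset, fun h => (h hu).2 rfl⟩ hsu hN).of_diff hu hsu (hP.conn _ hu _ hs)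
      (hF.nice.accessible_corner hF.fin hF.compl (hA.sub huA) (hright y huA) htop (hrd y huA)
        (Set.sdiff_subset.trans hF.sub) (by simp))
  · push Not at hb
    obtain ⟨hl, hd, hx⟩ := hb
    have hxF := hcorner (hF.sub hl) (hF.sub hd)
    have hA1 := hdown y huA (hF.sub hd)
    obtain ⟨_, _, hsq⟩ := hP.hole_square hl hd (Conn.refl hx)
    have hole : ∀ q, Near q (x' - 2, y - 2) → q ∉ P ∧ q ∈ F := fun q hq =>
      ⟨notMem_of_clear hsq.left_mem hq, hF.mem_of_conn hxF
        ((conn_of_near hsq.left_mem (by simp only [Near]; omega)).symm.trans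
          (conn_of_near hsq.left_mem hq))⟩
    -- Neighbours of filled positions belong to `F`, so the square of the hole forces the column
    -- down to row `y - 3`.
    have next : ∀ z, y - 3 ≤ z → z ≤ y - 1 → (x', z) ∈ F := fun z h1 h2 => by
      have h := hole (x' - 1, z) (by simp only [Near]; omega)
      simpa using hF.hole _ h.2 h.1 _ (adj_right _ _)
    have hA2 := hdown _ hA1 (next _ (by omega) (by omega))
    have hA3 := hdown _ hA2 (next _ (by omega) (by omega))
    have hcol : ∀ k : ℤ, 0 ≤ k → k ≤ 3 → (x', y - k) ∈ A := fun k h0 h3 => by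
      obtain rfl | rfl | rfl | rfl : k = 0 ∨ k = 1 ∨ k = 2 ∨ k = 3 := by omega
      · simpa using huA
      · exact hA1
      · rwa [sub_sub] at hA2
      · rwa [sub_sub, sub_sub] at hA3
    have h : HoleCorner P F x' y := by
      refine ⟨hl, htop, hx, hxF, fun k h0 h3 => htile _ (hcol k h0 h3), fun k h0 h4 => ?_⟩
      by_cases hk : k = 4
      · subst hk
        have := hrd _ hA3
        rwa [sub_sub, sub_sub, sub_sub] at this
      · exact hright _ (hcol k h0 (by omega))
    have hsc : s ∈ HoleCorner.cut P x' y 4 := by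
      refine ⟨hs, fun hc => hA.seed_notMem ?_⟩
      have := hcol (y - s.2) (by omega) (by omega)
      rwa [sub_sub_cancel, ← hc.1] at this
    refine h.assembly hP hfin hF hsc (ih _ ⟨HoleCorner.cut_subset _ _ _ _, fun hsub => ?_⟩ hsc
      (h.nice_cut hP hfin hF))
    exact (hsub hu).2 ⟨rfl, by dsimp only; omega, le_rfl⟩

/-- Bijections of the grid that preserve its geometry and swap the two directions. -/
structure QuarterTurn (e : Pos ≃ Pos) : Prop where
  adj : ∀ p q, gridGraph.Adj (e p) (e q) ↔ gridGraph.Adj p q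
  near : ∀ p q, Near (e p) (e q) ↔ Near p q
  far : ∀ R p, Far R (e p) ↔ Far R p
  diag : ∀ p q, (q.1 = p.1 + 1 ∨ q.1 = p.1 - 1) → (q.2 = p.2 + 1 ∨ q.2 = p.2 - 1) →
    ((e q).1 = (e p).1 + 1 ∨ (e q).1 = (e p).1 - 1) ∧
      ((e q).2 = (e p).2 + 1 ∨ (e q).2 = (e p).2 - 1)
  corner : ∀ p q, ((e p).1, (e q).2) = e (q.1, p.2)

/-- The counterclockwise rotation by a right angle. -/
def rot : Pos ≃ Pos where
  toFun p := (-p.2, p.1)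
  invFun p := (p.2, -p.1)
  left_inv p := by simp
  right_inv p := by simp

theorem quarterTurn_rot : QuarterTurn rot where
  adj p q := by simp only [adj_iff, rot, Equiv.coe_fn_mk]; omega
  near p q := by simp only [Near, rot, Equiv.coe_fn_mk]; omega
  far R p := by simp only [Far, rot, Equiv.coe_fn_mk]; omega
  diag p q h h' := by simp only [rot, Equiv.coe_fn_mk]; omega
  corner p q := by simp [rot]

theorem quarterTurn_rot_symm : QuarterTurn rot.symm where
  adj p q := by simp only [adj_iff, rot, Equiv.coe_fn_symm_mk]; omega
  near p q := by simp only [Near, rot, Equiv.coe_fn_symm_mk]; omega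
  far R p := by simp only [Far, rot, Equiv.coe_fn_symm_mk]; omega
  diag p q h h' := by simp only [rot, Equiv.coe_fn_symm_mk]; omega
  corner p q := by simp [rot]

namespace QuarterTurn
variable {e : Pos ≃ Pos}

theorem conn_iff (he : QuarterTurn e) {A : Set Pos} {p q : Pos} :
    Conn (e ⁻¹' A) p q ↔ Conn A (e p) (e q) := by
  constructor
  · exact fun h => h.induct (C := fun z => Conn A (e p) (e z)) (.refl h.left_mem)
      fun x y hx hy hxy h => h.trans (.single hx hy ((he.adj _ _).2 hxy))
  · intro h
    have := h.induct (C := fun z => Conn (e ⁻¹' A) p (e.symm z))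
      (by rw [e.symm_apply_apply]; exact .refl h.left_mem) fun x y hx hy hxy h =>
        h.trans (.single (by simpa using hx) (by simpa using hy) ((he.adj _ _).1 (by simpa using hxy)))
    simpa using this

theorem clear_preimage (he : QuarterTurn e) (Q : Set Pos) :
    Clear (e ⁻¹' Q) = e ⁻¹' Clear Q := by
  ext c
  constructor
  · intro h p hp hn
    exact h (e.symm p) (by simpa using hp) ((he.near _ _).1 (by simpa using hn))
  · exact fun h p hp hn => h (e p) hp ((he.near _ _).2 hn)

theorem nice (he : QuarterTurn e) {Q : Set Pos} (hQ : Nice Q) : Nice (e ⁻¹' Q) := by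
  refine ⟨fun p hp q hq => he.conn_iff.2 (hQ.conn _ hp _ hq), fun p hp q hq h1 h2 => ?_,
    fun p q h => ?_⟩
  · obtain ⟨h1, h2⟩ := he.diag p q h1 h2
    have := hQ.nondeg _ hp _ hq h1 h2
    rw [he.corner, he.corner] at this
    exact this.symm
  · obtain ⟨a, b, ha, hb, hab⟩ := hQ.empty _ _ (he.conn_iff (A := Qᶜ).1 h)
    refine ⟨e.symm a, e.symm b, (he.near _ _).1 (by simpa using ha),
      (he.near _ _).1 (by simpa using hb), ?_⟩
    rw [he.clear_preimage, he.conn_iff]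
    simpa using hab

theorem filling (he : QuarterTurn e) {P F : Set Pos} (h : Filling P F) :
    Filling (e ⁻¹' P) (e ⁻¹' F) where
  sub := Set.preimage_mono h.sub
  nice := he.nice h.nice
  fin := h.fin.preimage e.injective.injOn
  compl _ hp _ hq := he.conn_iff (A := Fᶜ).2 (h.compl _ hp _ hq)
  hole _ hp hpP _ hpq := h.hole _ hp hpP _ ((he.adj _ _).2 hpq)

theorem lobe (he : QuarterTurn e) {F A : Set Pos} {s t : Pos} (h : Lobe F (e s) (e t) A) :
    Lobe (e ⁻¹' F) s t (e ⁻¹' A) where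
  sub := Set.preimage_mono h.sub
  nonempty := h.nonempty.preimage e.surjective
  mem := h.mem
  notMem := h.notMem
  seed_notMem := h.seed_notMem
  closed a ha b hb hab := (h.closed _ ha _ hb ((he.adj _ _).2 hab)).imp_right (e.injective ·)
  noncut u hu p hp q hq := by
    have h1 : e ⁻¹' F \ {u} = e ⁻¹' (F \ {e u}) := by ext z; simp
    rw [h1] at hp hq ⊢
    exact he.conn_iff.2 (h.noncut _ hu _ hp _ hq)

theorem accessible (he : QuarterTurn e) {A : Set Pos} {u : Pos} (h : Accessible A (e u)) :
    Accessible (e ⁻¹' A) u := by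
  obtain ⟨R, h⟩ := h
  refine ⟨R, fun z hz => ?_⟩
  obtain ⟨p, hp, hpu⟩ := h (e z) ((he.far _ _).2 hz)
  refine ⟨e.symm p, (he.near _ _).1 (by simpa using hp), ?_⟩
  have := hpu.lift (p := FreeMove (e ⁻¹' A)) e.symm fun a b hab =>
    ⟨by simpa using hab.1, fun r hr => hab.2.1 _ (by simpa using (he.adj _ _).2 hr),
      (he.adj _ _).1 (by simpa using hab.2.2)⟩
  simpa [Function.onFun] using this

theorem assembly (he : QuarterTurn e) {A : Set Pos} {s : Pos} (h : Assembly (e s) A) :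
    Assembly s (e ⁻¹' A) := by
  induction h with
  | seed =>
    have : e ⁻¹' {e s} = {s} := by ext z; simp
    rw [this]
    exact .seed
  | step A q _ hq hacc hadj ih =>
    have h1 : e ⁻¹' insert q A = insert (e.symm q) (e ⁻¹' A) := by
      ext z
      simp [Equiv.eq_symm_apply]
    obtain ⟨r, hr, hqr⟩ := hadj
    rw [h1]
    exact .step _ _ ih (by simpa using hq) (he.accessible (by simpa using hacc))
      ⟨e.symm r, by simpa using hr, (he.adj _ _).1 (by simpa using hqr)⟩
end QuarterTurn

/-- Lobes that contain a tile with a larger value of `φ` than their attachment can be used to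
assemble `P`. -/
def LobeStep (φ : Pos → ℤ) : Prop :=
  ∀ (P F A : Set Pos) (s t : Pos), Nice P → P.Finite → Filling P F → s ∈ P → Lobe F s t A →
    (∀ Q, Q ⊂ P → s ∈ Q → Nice Q → Assembly s Q) → (∃ a ∈ A, φ t < φ a) → Assembly s P

/-- Iterated from `lobeStep_fst`, this covers all four directions in which a lobe may leave its
attachment. -/
theorem LobeStep.comp_rot {φ : Pos → ℤ} (h : LobeStep φ) : LobeStep (φ ∘ rot) := by
  intro P F A s t hP hfin hF hs hA ih ⟨a, ha, hta⟩
  have key : Assembly (rot s) (rot.symm ⁻¹' P) := by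
    refine h _ (rot.symm ⁻¹' F) (rot.symm ⁻¹' A) _ (rot t) (quarterTurn_rot_symm.nice hP)
      (hfin.preimage rot.symm.injective.injOn) (quarterTurn_rot_symm.filling hF) (by simpa using hs)
      (quarterTurn_rot_symm.lobe (by simpa using hA)) (fun Q hQ hsQ hN => ?_)
      ⟨rot a, by simpa using ha, hta⟩
    have h1 := ih (rot ⁻¹' Q) ?_ hsQ (quarterTurn_rot.nice hN)
    · have := quarterTurn_rot_symm.assembly (s := rot s) (by simpa using h1)
      simpa [← Set.preimage_comp] using this
    · refine ⟨fun p hp => by simpa using hQ.1 hp, fun hsub => hQ.2 fun p hp => ?_⟩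
      simpa using hsub hp
  simpa [← Set.preimage_comp] using quarterTurn_rot.assembly key

theorem lobeStep_fst : LobeStep Prod.fst :=
  fun _ _ _ _ _ hP hfin hF hs hA ih ht => assembly_of_lobe_right hP hfin hF hs hA ih ht

/-- Nice sets can be assembled from any of their tiles. -/
theorem Nice.assembly {P : Set Pos} (hP : Nice P) (hfin : P.Finite) {s : Pos} (hs : s ∈ P) :
    Assembly s P := by
  induction hn : P.ncard using Nat.strong_induction_on generalizing P with
  | _ n ih =>
  by_cases hv : ∃ v ∈ P, v ≠ s
  · obtain ⟨v, hv, hvs⟩ := hv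
    obtain ⟨F, hF⟩ := hP.exists_filling hfin
    obtain ⟨t, A, hA⟩ := exists_lobe hF.nice.conn hF.fin (hF.sub hs) (hF.sub hv) hvs
    have ih' : ∀ Q, Q ⊂ P → s ∈ Q → Nice Q → Assembly s Q := fun Q hQ hsQ hN =>
      ih _ (hn ▸ Set.ncard_lt_ncard hQ hfin) hN (hfin.subset hQ.1) hsQ rfl
    have h1 := lobeStep_fst
    have h2 := h1.comp_rot
    have h3 := h2.comp_rot
    have h4 := h3.comp_rot
    obtain ⟨a, ha⟩ := hA.nonempty
    have hat : a ≠ t := fun h => hA.notMem (h ▸ ha)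
    have hat : ¬ (a.1 = t.1 ∧ a.2 = t.2) := fun h => hat (Prod.ext h.1 h.2)
    by_cases c1 : t.1 < a.1
    · exact h1 P F A s t hP hfin hF hs hA ih' ⟨a, ha, c1⟩
    by_cases c2 : a.2 < t.2
    · exact h2 P F A s t hP hfin hF hs hA ih' ⟨a, ha, by simp [rot, c2]⟩
    by_cases c3 : a.1 < t.1
    · exact h3 P F A s t hP hfin hF hs hA ih' ⟨a, ha, by simp [rot, c3]⟩
    · exact h4 P F A s t hP hfin hF hs hA ih' ⟨a, ha, by simp [rot]; omega⟩
  · push Not at hv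
    have : P = {s} := Set.eq_singleton_iff_unique_mem.2 ⟨hs, hv⟩
    rw [this]
    exact .seed

/-! ### Fitting the assembly into the workspace -/

theorem Assembly.seed_mem {s : Pos} {A : Set Pos} (h : Assembly s A) : s ∈ A := by
  induction h with
  | seed => rfl
  | step A q _ _ _ _ ih => exact .inr ih

/-- The tiles of an assembly are at a distance less than the number of tiles from the seed. -/
theorem Assembly.finite_and_dist_lt {s : Pos} {A : Set Pos} (h : Assembly s A) :
    A.Finite ∧ ∀ p ∈ A, |p.1 - s.1| + |p.2 - s.2| < A.ncard := by
  induction h with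
  | seed => simp
  | step A q _ hq _ hadj ih =>
    obtain ⟨hfin, ih⟩ := ih
    refine ⟨hfin.insert q, ?_⟩
    rw [Set.ncard_insert_of_notMem hq hfin]
    push_cast
    rintro p (rfl | hp)
    · obtain ⟨r, hr, hpr⟩ := hadj
      have h1 := ih r hr
      have h2 : |p.1 - r.1| + |p.2 - r.2| = 1 := hpr
      have h3 := abs_sub_le p.1 r.1 s.1
      have h4 := abs_sub_le p.2 r.2 s.2
      omega
    · have := ih p hp
      omega

/-- The position of the workspace closest to `p`. -/
def clamp (n : ℕ) (p : Pos) : Pos := (max 0 (min (2 * n - 1) p.1), max 0 (min (2 * n - 1) p.2))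

/-- Paths in the unbounded plane that start at the lower left of the workspace can be pushed into
the workspace. -/
theorem reflTransGen_move_of_freeMove {n : ℕ} (hn : 1 ≤ n) {A : Finset Pos}
    (hA : ∀ p ∈ A, 2 ≤ p.1 ∧ p.1 ≤ 2 * n - 3 ∧ 2 ≤ p.2 ∧ p.2 ≤ 2 * n - 3) {p q : Pos}
    (hp : p.1 ≤ 0 ∧ p.2 ≤ 0) (hq : q ∈ workspace n)
    (h : ReflTransGen (FreeMove (A : Set Pos)) p q) : ReflTransGen (Move n A) (0, 0) q := by
  have hws : ∀ z, clamp n z ∈ workspace n := fun z => by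
    simp only [clamp, workspace, Set.mem_ofPred_eq]; omega
  have hid : ∀ z ∈ workspace n, clamp n z = z := fun z hz => by
    simp only [workspace, Set.mem_ofPred_eq] at hz
    ext <;> simp only [clamp] <;> omega
  have key : ReflTransGen (Move n A) (0, 0) (clamp n q) := by
    clear hq
    induction h with
    | refl =>
      have : clamp n p = (0, 0) := by ext <;> simp only [clamp] <;> omega
      rw [this]
    | @tail b c _ hbc ih =>
      by_cases hbcc : clamp n b = clamp n c
      · rwa [← hbcc]
      -- If clamping moves `b`, the result lies on the border of the workspace, at least two steps
      -- from every tile.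
      have hmem : ∀ r, (r = clamp n b ∨ gridGraph.Adj (clamp n b) r) → r ∉ A := fun r hr hrA => by
        by_cases hb : b ∈ workspace n
        · rw [hid b hb] at hr
          rcases hr with rfl | hr
          · exact hbc.1 hrA
          · exact hbc.2.1 r hr hrA
        · have := hA r hrA
          simp only [workspace, Set.mem_ofPred_eq] at hb
          simp only [adj_iff, clamp, Prod.ext_iff] at hr
          omega
      refine ih.tail ⟨hws b, hws c, hmem _ (.inl rfl), ?_, fun r hr => hmem r (.inr hr)⟩
      have hstep : ∀ i : ℤ, max 0 (min (2 * (n : ℤ) - 1) (i + 1)) = max 0 (min (2 * (n : ℤ) - 1) i) ∨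
          max 0 (min (2 * (n : ℤ) - 1) (i + 1)) = max 0 (min (2 * (n : ℤ) - 1) i) + 1 := fun i => by omega
      obtain ⟨x, y⟩ := b
      change gridGraph.Adj (clamp n (x, y)) (clamp n c)
      simp only [clamp, Prod.mk.injEq] at hbcc
      rcases adj_cases hbc.2.2 with rfl | rfl | rfl | rfl
      · have := hstep x
        simp only [clamp, adj_iff, and_true] at hbcc ⊢
        tauto
      · have := hstep (x - 1)
        rw [sub_add_cancel] at this
        simp only [clamp, adj_iff, and_true] at hbcc ⊢
        omega
      · have := hstep y
        simp only [clamp, adj_iff, true_and] at hbcc ⊢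
        tauto
      · have := hstep (y - 1)
        rw [sub_add_cancel] at this
        simp only [clamp, adj_iff, true_and] at hbcc ⊢
        omega
  rwa [hid q hq] at key

/-- In the smallest workspace, the second tile can be moved to the seed from the left or from
below. -/
theorem reflTransGen_move_two {A : Finset Pos} (hA : ∀ z ∈ A, z = (2, 2)) {q : Pos}
    (hq : q = (1, 2) ∨ q = (2, 1)) : ReflTransGen (Move 2 A) (0, 0) q := by
  have key : ∀ p q : Pos, 0 ≤ p.1 → p.1 ≤ 2 → 0 ≤ p.2 → p.2 ≤ 2 → p.1 + p.2 ≤ 2 → p ≠ (1, 1) →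
      (q = (p.1 + 1, p.2) ∨ q = (p.1, p.2 + 1)) → Move 2 A p q := by
    rintro ⟨a, b⟩ q h1 h2 h3 h4 h5 h6 hq
    have h6 : ¬ (a = 1 ∧ b = 1) := fun h => h6 (by simp [h])
    dsimp only at *
    refine ⟨?_, ?_, fun h => ?_, ?_, fun r hr h => ?_⟩
    · simp only [workspace, Set.mem_ofPred_eq]; omega
    · rcases hq with rfl | rfl <;> simp only [workspace, Set.mem_ofPred_eq] <;> omega
    · have := hA _ h
      simp only [Prod.mk.injEq] at this
      omega
    · rcases hq with rfl | rfl
      · exact adj_right _ _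
      · exact adj_up _ _
    · have h7 := hA _ h
      subst h7
      have h8 : gridGraph.Adj (a, b) (2, 2) := hr
      simp only [adj_iff] at h8
      omega
  rcases hq with rfl | rfl
  · exact ((ReflTransGen.single (key (0, 0) (0, 1) (by simp) (by simp) (by simp) (by simp) (by simp)
      (by simp) (by simp))).tail (key (0, 1) (0, 2) (by simp) (by simp) (by simp) (by simp) (by simp)
      (by simp) (by simp))).tail (key (0, 2) (1, 2) (by simp) (by simp) (by simp) (by simp) (by simp)
      (by simp) (by simp))
  · exact ((ReflTransGen.single (key (0, 0) (1, 0) (by simp) (by simp) (by simp) (by simp) (by simp)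
      (by simp) (by simp))).tail (key (1, 0) (2, 0) (by simp) (by simp) (by simp) (by simp) (by simp)
      (by simp) (by simp))).tail (key (2, 0) (2, 1) (by simp) (by simp) (by simp) (by simp) (by simp)
      (by simp) (by simp))

/-- Assembling inside the workspace, with a seed tile for which the sum of the coordinates is
maximal. -/
theorem Assembly.assembles {P : Finset Pos} {s v : Pos} (hmax : ∀ p ∈ P, p.1 + p.2 ≤ s.1 + s.2)
    (hv1 : s.1 + v.1 = P.card) (hv2 : s.2 + v.2 = P.card) {A : Set Pos} (h : Assembly s A)
    (hAP : A ⊆ P) : ∃ A' : Finset Pos, (∀ z, z ∈ A' ↔ z - v ∈ A) ∧ Assembles P.card A' := by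
  induction h with
  | seed =>
    refine ⟨{((P.card : ℤ), (P.card : ℤ))}, fun z => ?_, .seed⟩
    simp only [Finset.mem_singleton, Set.mem_singleton_iff, Prod.ext_iff, Prod.fst_sub, Prod.snd_sub]
    omega
  | step A q hA hq hacc hadj ih =>
    obtain ⟨A', hA', has⟩ := ih ((Set.subset_insert _ _).trans hAP)
    have hAmem : ∀ z, z + v ∈ A' ↔ z ∈ A := fun z => by rw [hA', add_sub_cancel_right]
    obtain ⟨hfin, hdist⟩ := hA.finite_and_dist_lt
    have hcard : A.ncard + 1 ≤ P.card := by
      rw [← Set.ncard_insert_of_notMem hq hfin, ← Set.ncard_coe_finset P]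
      exact Set.ncard_le_ncard hAP P.finite_toSet
    have hpos : 1 ≤ A.ncard := (Set.ncard_pos hfin).2 ⟨s, hA.seed_mem⟩
    have hbound : ∀ p ∈ A, |p.1 - s.1| + |p.2 - s.2| + 2 ≤ P.card := fun p hp => by
      have := hdist p hp
      omega
    have hqP : q ∈ P := hAP (.inl rfl)
    obtain ⟨r, hr, hqr⟩ := hadj
    refine ⟨insert (q + v) A', fun z => ?_, .step A' (q + v) has ⟨?_, ?_, r + v, (hAmem r).2 hr, ?_⟩⟩
    · rw [Finset.mem_insert, Set.mem_insert_iff, hA', sub_eq_iff_eq_add]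
    · have hqr' := hqr
      rw [adj_iff] at hqr'
      have hrb := hbound r hr
      have b1 := le_abs_self (r.1 - s.1)
      have b2 := neg_abs_le (r.1 - s.1)
      have b3 := le_abs_self (r.2 - s.2)
      have b4 := neg_abs_le (r.2 - s.2)
      have b5 := abs_nonneg (r.1 - s.1)
      have b6 := abs_nonneg (r.2 - s.2)
      have hqm := hmax q hqP
      -- With `n = P.card`, the offsets of earlier tiles from the seed satisfy `|dx| + |dy| ≤ n - 2`
      -- and `dx + dy ≤ 0`. So each is at most `(n - 2) / 2`, hence at most `n - 3` once `n ≥ 3`,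
      -- which gives the required margin. For `n = 2` it fails, but maximality puts `q` left of or
      -- below the seed.
      obtain h2 | h3 : P.card = 2 ∨ 3 ≤ P.card := by omega
      · rw [h2] at hv1 hv2 hrb ⊢
        push_cast at hv1 hv2 hrb
        refine reflTransGen_move_two (fun z hz => ?_) ?_
        · have hz' := hbound _ ((hA' z).1 hz)
          rw [h2] at hz'
          push_cast at hz'
          have c1 := abs_nonneg ((z - v).1 - s.1)
          have c2 := abs_nonneg ((z - v).2 - s.2)
          have c3 := abs_eq_zero.1 (by omega : |(z - v).1 - s.1| = 0)
          have c4 := abs_eq_zero.1 (by omega : |(z - v).2 - s.2| = 0)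
          simp only [Prod.fst_sub, Prod.snd_sub] at c3 c4
          ext <;> dsimp only <;> omega
        · simp only [Prod.ext_iff, Prod.fst_add, Prod.snd_add]
          omega
      · obtain ⟨R, hR⟩ := hacc
        have d1 := neg_abs_le R
        have d2 := le_abs_self R
        have d3 := le_abs_self v.1
        have d4 := le_abs_self v.2
        have d5 := abs_nonneg v.1
        have d6 := abs_nonneg v.2
        -- A point so far down and left that, after translation by `v`, its whole `3 × 3` square has
        -- coordinates at most `0`.
        obtain ⟨p, hp, hpq⟩ := hR (-(|R| + |v.1| + |v.2| + 1), -(|R| + |v.1| + |v.2| + 1))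
          (by simp only [Far]; omega)
        have hpq' : ReflTransGen (FreeMove (A' : Set Pos)) (p + v) (q + v) := by
          refine hpq.lift (p := FreeMove (A' : Set Pos)) (· + v) fun a b hab =>
            ⟨fun h => hab.1 ((hAmem a).1 h), fun z hz h => hab.2.1 (z - v) ?_ ((hA' z).1 h), ?_⟩
          · have h2 := hab.2.2
            dsimp only
            rw [adj_iff] at h2 ⊢
            simp only [Prod.fst_add, Prod.snd_add]
            omega
          · dsimp only at hz
            rw [adj_iff] at hz ⊢
            simp only [Prod.fst_add, Prod.snd_add, Prod.fst_sub, Prod.snd_sub] at hz ⊢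
            omega
        refine reflTransGen_move_of_freeMove (by omega) (fun z hz => ?_) ?_ ?_ hpq'
        · have hz' := (hA' z).1 hz
          have e0 := hbound _ hz'
          have e1 := hmax _ (hAP (.inr hz'))
          have c1 := le_abs_self ((z - v).1 - s.1)
          have c2 := neg_abs_le ((z - v).1 - s.1)
          have c3 := le_abs_self ((z - v).2 - s.2)
          have c4 := neg_abs_le ((z - v).2 - s.2)
          generalize |(z - v).1 - s.1| = w1 at *
          generalize |(z - v).2 - s.2| = w2 at *
          simp only [Prod.fst_sub, Prod.snd_sub] at c1 c2 c3 c4 e1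
          omega
        · simp only [Near] at hp
          simp only [Prod.fst_add, Prod.snd_add]
          omega
        · simp only [workspace, Set.mem_ofPred_eq, Prod.fst_add, Prod.snd_add]
          omega
    · rwa [hAmem]
    · have h2 := hqr
      change gridGraph.Adj (q + v) (r + v)
      rw [adj_iff] at h2 ⊢
      simp only [Prod.fst_add, Prod.snd_add]
      omega

theorem nice_of_isPolyomino {P : Finset Pos} (hP : IsPolyomino P) (hnd : ¬ IsDegenerate P)
    (h3 : IsEmptyFor 3 P) : Nice (P : Set Pos) := by
  refine ⟨fun p hp q hq => conn_of_joinedIn ⟨hp, hq, hP.preconnected _ _⟩,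
    fun p hp q hq h1 h2 => ?_, fun p q hpq => ?_⟩
  · have hs : ShareOnePoint p q := by
      constructor <;> rw [abs_eq (by norm_num)] <;> omega
    have : ∃ t ∈ P, t ∈ N p ∩ N q := by
      by_contra! h
      exact hnd ⟨p, hp, q, hq, hs, h⟩
    obtain ⟨t, ht, hpt, hqt⟩ := this
    have hpt : gridGraph.Adj p t := hpt
    have hqt : gridGraph.Adj q t := hqt
    rw [adj_iff] at hpt hqt
    obtain h | h : t = (p.1, q.2) ∨ t = (q.1, p.2) := by
      simp only [Prod.ext_iff]; omega
    · exact .inl (h ▸ ht)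
    · exact .inr (h ▸ ht)
  · obtain ⟨a, b, ha, hb, hab⟩ := h3 p q hpq.joinedIn
    -- `square` is anchored at its lower left position, `Near` at the centre.
    have hsq : ∀ z c : Pos, z ∈ square 3 c ↔ Near z (c + (1, 1)) := fun z c => by
      simp only [square, Near, Set.mem_ofPred_eq, Prod.fst_add, Prod.snd_add]
      push_cast
      omega
    have hcl : ∀ c ∈ clearPlacements 3 P, c + (1, 1) ∈ Clear (P : Set Pos) := fun c hc z hz hn =>
      Set.disjoint_left.1 hc ((hsq z c).2 hn) hz
    have hab := conn_of_joinedIn hab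
    refine ⟨a + (1, 1), b + (1, 1), (hsq _ _).1 ha, (hsq _ _).1 hb, ?_⟩
    refine hab.induct (C := fun z => Conn (Clear (P : Set Pos)) (a + (1, 1)) (z + (1, 1)))
      (.refl (hcl _ hab.left_mem)) fun x y hx hy hxy h =>
        h.trans (.single (hcl _ hx) (hcl _ hy) ?_)
    rw [adj_iff] at hxy ⊢
    simp only [Prod.fst_add, Prod.snd_add]
    omega

end SingleStepTilt

theorem mainTheorem7 (P : Finset SingleStepTilt.Pos) (hP : SingleStepTilt.IsPolyomino P)
    (hnd : ¬ SingleStepTilt.IsDegenerate P) (h3 : SingleStepTilt.IsEmptyFor 3 P) :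
    SingleStepTilt.IsConstructible P := by
  have hN := SingleStepTilt.nice_of_isPolyomino hP hnd h3
  obtain ⟨⟨p, hp⟩⟩ := hP.nonempty
  obtain ⟨s, hs, hmax⟩ := P.exists_max_image (fun p => p.1 + p.2) ⟨p, hp⟩
  obtain ⟨A', hA', has⟩ := (hN.assembly P.finite_toSet hs).assembles
    (v := ((P.card : ℤ) - s.1, (P.card : ℤ) - s.2)) hmax (by simp) (by simp) subset_rfl
  refine ⟨((P.card : ℤ) - s.1, (P.card : ℤ) - s.2), ?_⟩
  convert has
  ext z
  rw [hA', Finset.mem_image]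
  constructor
  · rintro ⟨a, ha, rfl⟩
    simpa using ha
  · exact fun h => ⟨_, h, sub_add_cancel _ _⟩
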